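/- **Sequences.** For a finite sequence $S=(a_1,\dots,a_n)$ in $\{+1,-1\}$ put $\overline S=(-a_n,\dots,-a_1)$. The empty sequence is the only $0$-folding sequence, and the $(n+1)$-folding sequences are the sequences $(\overline S,+1,S)$ and $(\overline S,-1,S)$ with $S$ an $n$-folding sequence (these are the crease patterns of a strip of paper folded $n+1$ times in two). A finite folding sequence is a block of consecutive terms of an $n$-folding sequence for some $n$. An $\infty$-folding sequence is a sequence $R=(a_h)_{h\ge 1}$ such that $(a_1,\dots,a_{2^n-1})$ is an $n$-folding sequence for each $n$. A complete folding sequence is a sequence $(a_h)_{h\in\mathbb Z}$ in $\{+1,-1\}$ all of whose finite blocks of consecutive terms are finite folding sequences. For $R=(a_h)_{h\ge1}$ and $\varepsilon\in\{+1,-1\}$, $(\overline R,\varepsilon,R)$ is the sequence indexed by $\mathbb Z$ whose term of index $k$ is $a_k$ if $k>0$, $\varepsilon$ if $k=0$, and $-a_{-k}$ if $k<0$. **Curves.** A segment is an oriented unit interval joining two neighbouring points of $\mathbb Z^2$ (its support), with each of its two ends bent slightly off the support, to its left or to its right, so that it stops at a small fixed distance from the grid point. Two segments are consecutive if the end of the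 first is the beginning of the second and they have no other common point; thus one turns left or right by a right angle, rounding the corner at their common grid point. A complete curve is a sequence $(C_i)_{i\in\mathbb Z}$ of segments with distinct supports such that $C_i,C_{i+1}$ are consecutive for every $i$; curves which differ by a shift of the index are identified. It is associated to $(\eta_i)_{i\in\mathbb Z}$, where $\eta_i=+1$ (resp. $-1$) if one turns left (resp. right) from $C_i$ to $C_{i+1}$. A complete folding curve is a complete curve associated to a complete folding sequence. **Coverings.** A covering of $\mathbb R^2$ is a set $\mathcal C$ of segments such that each unit interval joining two neighbouring points of $\mathbb Z^2$ is the support of exactly one segment of $\mathcal C$ and, whenever two distinct non-consecutive segments of $\mathcal C$ have a common endpoint $X$ (an endpoint of their supports), they can be completed in $\mathcal C$ into two pairs of consecutive segments, the four segments having distinct supports which contain $X$. It is a covering by complete folding curves if it is a union of disjoint complete folding curves. It satisfies the local isomorphism property if for each finite $\mathcal F\subset\mathcal C$ there is $r>0$ such that every disk of radius $r$ in $\mathbb R^2$ contains the image, contained in $\mathcal C$, of $\mathcal F$ under a translation. **Theorem 3.15.** Let $R=(a_h)_{h\ge1}$ be an $\infty$-folding sequence, let $S=(\overline R,+1,R)$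 or $S=(\overline R,-1,R)$, and let $C$ be a complete curve associated to $S$. Then there is a unique covering $\mathcal C\supset C$ of $\mathbb R^2$ by complete folding curves which satisfies the local isomorphism property. Moreover: 1) if $\{n\in\mathbb N\mid a_{2^n}=(-1)^n\}$ (where $0\in\mathbb N$) is finite or cofinite, then $\mathcal C$ consists of exactly $6$ curves, of which exactly $2$ are associated to $S$ and the $4$ others are not; 2) otherwise, $\mathcal C$ consists of exactly $2$ curves, both associated to $S$. -/

import Mathlib

namespace Paperfolding

/-! ### Paperfolding sequences

Signs `+1`, `-1` are elements of `ℤˣ`. -/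

/-- `bar (a₁, …, aₙ) = (-aₙ, …, -a₁)`. -/
def bar (S : List ℤˣ) : List ℤˣ := (S.map (fun x => -x)).reverse

/-- `n`-folding sequences: nothing is written for an unfolded strip; a strip that is first folded
in two (crease `ε` in the middle, up or down) and then folded `n` more times shows, once unfolded,
an `n`-folding sequence `S` on its right half and `bar S` on its left half. -/
inductive IsNFolding : ℕ → List ℤˣ → Prop
  | zero : IsNFolding 0 []
  | succ {n : ℕ} {S : List ℤˣ} (ε : ℤˣ) (h : IsNFolding n S) :
      IsNFolding (n + 1) (bar S ++ ε :: S)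

/-- A finite folding sequence is a (contiguous) subword of an `n`-folding sequence. -/
def IsFiniteFolding (L : List ℤˣ) : Prop := ∃ n S, IsNFolding n S ∧ L <:+: S

/-- `(a₁, a₂, …)` is an `∞`-folding sequence: each `(a₁, …, a_{2^n - 1})` is an `n`-folding
sequence. The value `a 0` is not used. -/
def IsInftyFolding (a : ℕ → ℤˣ) : Prop :=
  ∀ n : ℕ, IsNFolding n ((List.range (2 ^ n - 1)).map (fun i => a (i + 1)))

/-- A complete folding sequence: every finite subword is a finite folding sequence. -/
def IsCompleteFolding (S : ℤ → ℤˣ) : Prop :=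
  ∀ (k : ℤ) (m : ℕ), IsFiniteFolding ((List.range m).map (fun i => S (k + (i : ℤ))))

/-- The two-sided sequence `(R̄, ε, R)` for `R = (a₁, a₂, …)`: its term of index `k` is `a k` if
`0 < k`, `ε` if `k = 0`, and `-a (-k)` if `k < 0`. -/
def twoSided (a : ℕ → ℤˣ) (ε : ℤˣ) (k : ℤ) : ℤˣ :=
  if 0 < k then a k.toNat else if k = 0 then ε else -a (-k).toNat

/-! ### Segments and curves -/

/-- An oriented segment of curve. Its support is the unit interval `[source, target]`, run from
`source` to `target`. Near each endpoint the segment leaves its support and stops at a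
small distance from the endpoint, on one of the two sides of the support: `bendSource` and
`bendTarget` are `+1` if it is the left side and `-1` if it is the right side, with respect to
the orientation of the segment. -/
@[ext]
structure Segment where
  source : ℤ × ℤ
  target : ℤ × ℤ
  bendSource : ℤˣ
  bendTarget : ℤˣ
  unit_length : (target.1 - source.1) ^ 2 + (target.2 - source.2) ^ 2 = 1

namespace Segment

/-- The support of a segment, given by the unordered pair of its endpoints. -/
def support (s : Segment) : Sym2 (ℤ × ℤ) := s(s.source, s.target)

/-- The direction of a segment, a unit vector. -/
def dir (s : Segment) : ℤ × ℤ := s.target - s.source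

/-- The image of a segment under the translation of vector `v`. -/
def translate (v : ℤ × ℤ) (s : Segment) : Segment where
  source := s.source + v
  target := s.target + v
  bendSource := s.bendSource
  bendTarget := s.bendTarget
  unit_length := by
    have h := s.unit_length
    simpa using h

end Segment

/-- The determinant of the directions of `s` and `t`: for perpendicular segments it is `+1` if one
turns left when passing from `s` to `t`, and `-1` if one turns right. -/
def turn (s t : Segment) : ℤ := s.dir.1 * t.dir.2 - s.dir.2 * t.dir.1

/-- `s` and `t` are consecutive: the end of `s` is the beginning of `t` and they have no other
common point. The end of `s` lies near the vertex `s.target`, behind it and on the side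
`s.bendTarget` of `s`. A segment with another support begins at that point exactly
when it starts from this vertex towards the side `s.bendTarget` of `s` and begins on its own side
of the same name. -/
def Consecutive (s t : Segment) : Prop :=
  t.source = s.target ∧ turn s t = (s.bendTarget : ℤ) ∧ t.bendSource = s.bendTarget

/-- A complete curve: a sequence, indexed by `ℤ`, of consecutive segments with distinct
supports. -/
def IsCompleteCurve (C : ℤ → Segment) : Prop :=
  (∀ i, Consecutive (C i) (C (i + 1))) ∧ Function.Injective (fun i => (C i).support)

/-- The complete curve `C` is associated to the sequence `S`: one turns left (resp. right) from
`C i` to `C (i + 1)` if `S i = +1` (resp. `S i = -1`). -/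
def IsAssociated (C : ℤ → Segment) (S : ℤ → ℤˣ) : Prop :=
  ∀ i, turn (C i) (C (i + 1)) = (S i : ℤ)

/-- `K` is the set of segments of a complete curve associated to `S`. (A complete curve up to
a shift of its indexation is the same thing as the set of its segments.) -/
def IsCurveAssociated (K : Set Segment) (S : ℤ → ℤˣ) : Prop :=
  ∃ C : ℤ → Segment, IsCompleteCurve C ∧ Set.range C = K ∧ IsAssociated C S

/-- `K` is the set of segments of a complete folding curve. -/
def IsFoldingCurve (K : Set Segment) : Prop :=
  ∃ S : ℤ → ℤˣ, IsCompleteFolding S ∧ IsCurveAssociated K S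

/-! ### Coverings of the plane -/

/-- `E` is a covering of the plane: every unit interval of the grid `ℤ²` is the support of exactly
one segment of `E`; and two distinct non consecutive segments of `E` with a common endpoint `X` can
be completed (in `E`) into pairs of consecutive segments, the four segments having distinct supports
which contain `X`. -/
def IsCovering (E : Set Segment) : Prop :=
  (∀ P Q : ℤ × ℤ, (Q.1 - P.1) ^ 2 + (Q.2 - P.2) ^ 2 = 1 → ∃! s, s ∈ E ∧ s.support = s(P, Q)) ∧
  ∀ s ∈ E, ∀ t ∈ E, s ≠ t → ¬ Consecutive s t → ¬ Consecutive t s →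
    ∀ X, X ∈ s.support → X ∈ t.support →
      ∃ u ∈ E, ∃ w ∈ E,
        (Consecutive s u ∨ Consecutive u s) ∧ (Consecutive t w ∨ Consecutive w t) ∧
        X ∈ u.support ∧ X ∈ w.support ∧
        [s.support, u.support, t.support, w.support].Nodup

/-- The complete curves contained in `E`, up to indexation. -/
def curvesIn (E : Set Segment) : Set (Set Segment) :=
  {K | K ⊆ E ∧ ∃ C : ℤ → Segment, IsCompleteCurve C ∧ Set.range C = K}

/-- `E` is a covering of the plane by complete folding curves: it is a covering, and it is the
union of disjoint complete folding curves. -/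
def IsCoveringByFoldingCurves (E : Set Segment) : Prop :=
  IsCovering E ∧ (∀ K ∈ curvesIn E, IsFoldingCurve K) ∧
    (curvesIn E).PairwiseDisjoint id ∧ ⋃₀ curvesIn E = E

/-- Local isomorphism property: for each finite `F ⊆ E` there is `r > 0` such that every disk of
radius `r` contains the image of `F` under a translation which maps `F` into `E`.
(A tile and the corresponding support are within a bounded distance of each other,
so that it does not matter whether the tiles or the supports are required to be in the disk.) -/
def LocalIsomorphismProperty (E : Set Segment) : Prop :=
  ∀ F : Set Segment, F ⊆ E → F.Finite → ∃ r : ℝ, 0 < r ∧ ∀ c : ℝ × ℝ, ∃ v : ℤ × ℤ, ∀ s ∈ F,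
    s.translate v ∈ E ∧
    ∀ X ∈ (s.translate v).support, ((X.1 : ℝ) - c.1) ^ 2 + ((X.2 : ℝ) - c.2) ^ 2 ≤ r ^ 2

/-- `E` is a covering of the plane by complete folding curves which satisfies the local isomorphism
property and contains the curve `C`. -/
def IsGoodCovering (C : ℤ → Segment) (E : Set Segment) : Prop :=
  IsCoveringByFoldingCurves E ∧ LocalIsomorphismProperty E ∧ Set.range C ⊆ E

end Paperfolding

/-! ### Directed edges, turn functions and `(1 + i)`-adic valuation. -/

namespace Paperfolding

/-! Identify the grid with `ℤ[i]`, with origin at the vertex between `C 0` and `C 1`. Edges are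
oriented in a chessboard way (`Compat`): at each vertex the outgoing edges are opposite, and so are
the incoming ones. A sign `T z` at each vertex then determines a covering (`cover`), whose curves
are the cycles of `next T`. Folding means (`Folds`) that on the vertices of valuation `n` the sign
is `a (2 ^ n)` times an alternating sign; only `T 0 = ε` is free.

The engine is derivation: merging the two edges around each odd vertex passed by a curve and
dividing by `1 + i` gives a covering of the same kind with shifted coefficients (`par`,
`Folds.shift`). Two edges lie on one curve exactly when their parents do (`sameCycle_par`,
`sameCycle_of_par`), so statements about curves are proved by induction along derivations.

Counting: the squared norm of the doubled midpoint decreases from parent to parent until it is 1 (an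
edge at the centre) or 5 (`nrm_descend`). The eight edges of norm 5 form two spirals: one falls onto
the centre at the next derivation, the other is sent into a spiral. The fall is avoided forever only
if the coefficients alternate. Thus there are always two curves through the centre, which are those
associated to `S`, and four others exactly when the coefficients eventually alternate
(`exists_noncentral`, `isCentral_of_not_alternating`).

Local isomorphism holds because the turn at a nonzero vertex is unchanged by multiples of a high
power of `1 + i`, and such translations preserving the turn at the centre are available near every
point.

Uniqueness: a curve through the centre contains all edges in arbitrarily large disks
(`exists_ball`). The local isomorphism property of a competitor `E` moves a segment `S` of `E`, with
a long piece of `C`, into such a disk, where `E` agrees with `C`. The long piece forces the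
translation to be divisible by a high power of `1 + i` (`exists_dbl_eq_tgt`), so moving back shows
that `S` belongs to `cover` (`eq_cover`). -/

/-- Multiplication by `1 + i`, where `ℤ × ℤ` is identified with `ℤ[i]`. -/
def dbl (z : ℤ × ℤ) : ℤ × ℤ := (z.1 - z.2, z.1 + z.2)

/-- Division by `1 + i`. -/
def half (z : ℤ × ℤ) : ℤ × ℤ := ((z.1 + z.2) / 2, (z.2 - z.1) / 2)

/-- `sgn n = (-1) ^ n`. -/
def sgn (n : ℤ) : ℤˣ := if n % 2 = 0 then 1 else -1

theorem sgn_congr {m n : ℤ} (h : m % 2 = n % 2) : sgn m = sgn n := by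
  rw [sgn, sgn, h]

/-- A directed edge: the vector `(p, q)` with origin `(x, y)`. -/
@[ext]
structure DEdge where
  x : ℤ
  y : ℤ
  p : ℤ
  q : ℤ

namespace DEdge

def src (s : DEdge) : ℤ × ℤ := (s.x, s.y)

def tgt (s : DEdge) : ℤ × ℤ := (s.x + s.p, s.y + s.q)

/-- Twice the midpoint. -/
def mid (s : DEdge) : ℤ × ℤ := (2 * s.x + s.p, 2 * s.y + s.q)

/-- `s` is a unit edge, and it is horizontal exactly when the parity of its source differs
from that of `k`. -/
def Compat (k : ℤ) (s : DEdge) : Prop := s.p ^ 2 + s.q ^ 2 = 1 ∧ (s.x + s.y + s.p + k) % 2 = 0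

end DEdge

open DEdge

theorem unit_cases {p q : ℤ} (h : p ^ 2 + q ^ 2 = 1) :
    (p = 1 ∧ q = 0) ∨ (p = -1 ∧ q = 0) ∨ (p = 0 ∧ q = 1) ∨ (p = 0 ∧ q = -1) := by
  have hp : p ≤ 1 := by nlinarith
  have hp' : -1 ≤ p := by nlinarith
  have hq : q ≤ 1 := by nlinarith
  have hq' : -1 ≤ q := by nlinarith
  interval_cases p <;> interval_cases q <;> simp_all

theorem unit_odd {p q : ℤ} (h : p ^ 2 + q ^ 2 = 1) : (p + q) % 2 = 1 := by
  rcases unit_cases h with ⟨rfl, rfl⟩ | ⟨rfl, rfl⟩ | ⟨rfl, rfl⟩ | ⟨rfl, rfl⟩ <;> decide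

/-- The successor of a directed edge: one turns at its target according to `T`. -/
def next (T : ℤ × ℤ → ℤˣ) : Equiv.Perm DEdge where
  toFun s := ⟨s.x + s.p, s.y + s.q, -(T s.tgt : ℤ) * s.q, (T s.tgt : ℤ) * s.p⟩
  invFun s := ⟨s.x - (T s.src : ℤ) * s.q, s.y + (T s.src : ℤ) * s.p,
    (T s.src : ℤ) * s.q, -(T s.src : ℤ) * s.p⟩
  left_inv s := by
    have h : ∀ t : ℤˣ, (t : ℤ) * t = 1 := by decide
    have h1 := h (T s.tgt)
    simp only [src, tgt] at *
    ext <;> simp only []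
    · linear_combination (-s.p) * h1
    · linear_combination (-s.q) * h1
    · linear_combination (s.p) * h1
    · linear_combination (s.q) * h1
  right_inv s := by
    have h : ∀ t : ℤˣ, (t : ℤ) * t = 1 := by decide
    have h1 := h (T s.src)
    have h2 : (s.x - (T s.src : ℤ) * s.q + (T s.src : ℤ) * s.q,
      s.y + (T s.src : ℤ) * s.p + -(T s.src : ℤ) * s.p) = s.src := by
      simp [src]
    simp only [tgt, h2]
    ext <;> simp only []
    · ring
    · ring
    · linear_combination (s.p) * h1
    · linear_combination (s.q) * h1

theorem next_apply (T : ℤ × ℤ → ℤˣ) (s : DEdge) : next T s =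
    ⟨s.x + s.p, s.y + s.q, -(T s.tgt : ℤ) * s.q, (T s.tgt : ℤ) * s.p⟩ := rfl

theorem next_symm_apply (T : ℤ × ℤ → ℤˣ) (s : DEdge) : (next T).symm s =
    ⟨s.x - (T s.src : ℤ) * s.q, s.y + (T s.src : ℤ) * s.p,
    (T s.src : ℤ) * s.q, -(T s.src : ℤ) * s.p⟩ := rfl

@[simp] theorem src_next (T : ℤ × ℤ → ℤˣ) (s : DEdge) : (next T s).src = s.tgt := rfl

theorem tgt_next_symm (T : ℤ × ℤ → ℤˣ) (s : DEdge) : ((next T).symm s).tgt = s.src := by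
  conv_rhs => rw [← (next T).apply_symm_apply s, src_next]

theorem units_cases (t : ℤˣ) : t = 1 ∨ t = -1 := Int.units_eq_one_or t

/-- At each vertex the outgoing edges are perpendicular to the incoming ones, so a quarter turn on
either side respects the orientation. -/
theorem compat_next {T : ℤ × ℤ → ℤˣ} {k : ℤ} {s : DEdge} :
    (next T s).Compat k ↔ s.Compat k := by
  have e : (-(T s.tgt : ℤ) * s.q) ^ 2 + ((T s.tgt : ℤ) * s.p) ^ 2 = s.p ^ 2 + s.q ^ 2 := by
    rcases units_cases (T s.tgt) with h | h <;> simp [h] <;> ring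
  simp only [Compat, next_apply, e]
  refine and_congr_right fun h => ?_
  have := unit_odd h
  rcases units_cases (T s.tgt) with h | h <;> simp [h] <;> omega

theorem compat_zpow {T : ℤ × ℤ → ℤˣ} {k : ℤ} {s : DEdge} (n : ℤ) :
    ((next T ^ n) s).Compat k ↔ s.Compat k := by
  induction n using Int.induction_on with
  | zero => simp
  | succ i ih => rw [add_comm, zpow_add, zpow_one, Equiv.Perm.mul_apply, compat_next, ih]
  | pred i ih =>
    rw [← ih, show (-(i : ℤ)) = 1 + (-(i : ℤ) - 1) by ring, zpow_add, zpow_one,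
      Equiv.Perm.mul_apply, compat_next, show (1 + (-(i : ℤ) - 1)) - 1 = -(i : ℤ) - 1 by ring]

theorem compat_sameCycle {T : ℤ × ℤ → ℤˣ} {k : ℤ} {s s' : DEdge}
    (h : (next T).SameCycle s s') (hs : s.Compat k) : s'.Compat k := by
  obtain ⟨n, rfl⟩ := h
  exact (compat_zpow n).2 hs

/-- The parity type of the derived covering. -/
def nextType (t : ℤˣ) (k : ℤ) : ℤ := if t = 1 then k else k + 1

/-- The parity types of the successive derived coverings. -/
def typeSeq : (ℕ → ℤˣ) → ℤ → ℕ → ℤ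
  | _, k, 0 => k
  | A, k, n + 1 => typeSeq (fun m => A (m + 1)) (nextType (A 0) k) n

/-- The turns at the vertices of a covering by folding curves with centre `0`. -/
def Folds (A : ℕ → ℤˣ) (k : ℤ) (T : ℤ × ℤ → ℤˣ) : Prop :=
  ∀ (n : ℕ) (z : ℤ × ℤ), (z.1 + z.2) % 2 = 1 → T (dbl^[n] z) = A n * sgn (z.1 + typeSeq A k n)

/-- Derivation discards the odd vertices and divides the others by `1 + i`, so each valuation drops
by one. -/
theorem Folds.shift {A : ℕ → ℤˣ} {k : ℤ} {T : ℤ × ℤ → ℤˣ} (h : Folds A k T) :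
    Folds (fun n => A (n + 1)) (nextType (A 0) k) (fun z => T (dbl z)) := by
  intro n z hz
  have := h (n + 1) z hz
  rw [Function.iterate_succ_apply'] at this
  exact this

theorem Folds.odd {A : ℕ → ℤˣ} {k : ℤ} {T : ℤ × ℤ → ℤˣ} (h : Folds A k T) {z : ℤ × ℤ}
    (hz : (z.1 + z.2) % 2 = 1) : T z = A 0 * sgn (z.1 + k) := h 0 z hz

theorem Folds.odd_of_even {A : ℕ → ℤˣ} {k : ℤ} {T : ℤ × ℤ → ℤˣ} (h : Folds A k T) {z : ℤ × ℤ}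
    (hz : (z.1 + z.2) % 2 = 1) (hk : (z.1 + k) % 2 = 0) : T z = A 0 := by
  rw [h.odd hz, sgn, if_pos hk, mul_one]

theorem Folds.odd_of_odd {A : ℕ → ℤˣ} {k : ℤ} {T : ℤ × ℤ → ℤˣ} (h : Folds A k T) {z : ℤ × ℤ}
    (hz : (z.1 + z.2) % 2 = 1) (hk : (z.1 + k) % 2 = 1) : T z = -A 0 := by
  rw [h.odd hz, sgn, if_neg (by omega), mul_neg_one]

theorem Folds.odd_neg {A : ℕ → ℤˣ} {k : ℤ} {T : ℤ × ℤ → ℤˣ} (h : Folds A k T) {z w : ℤ × ℤ}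
    (hz : (z.1 + z.2) % 2 = 1) (hw : (w.1 + w.2) % 2 = 1) (hzw : (w.1 - z.1) % 2 = 1) :
    T w = -T z := by
  rcases Int.emod_two_eq (z.1 + k) with h0 | h0
  · rw [h.odd_of_even hz h0, h.odd_of_odd hw (by omega)]
  · rw [h.odd_of_odd hz h0, h.odd_of_even hw (by omega), neg_neg]

theorem half_dbl (z : ℤ × ℤ) : half (dbl z) = z := by
  ext <;> simp only [half, dbl] <;> omega

theorem dbl_half {z : ℤ × ℤ} (h : (z.1 + z.2) % 2 = 0) : dbl (half z) = z := by
  ext <;> simp only [half, dbl] <;> omega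

theorem dbl_injective : Function.Injective dbl := Function.LeftInverse.injective half_dbl

theorem dbl_even (z : ℤ × ℤ) : ((dbl z).1 + (dbl z).2) % 2 = 0 := by
  simp only [dbl]; omega

theorem dbl_zero : dbl 0 = 0 := rfl

/-- The squared euclidean norm. -/
def nrm (z : ℤ × ℤ) : ℤ := z.1 ^ 2 + z.2 ^ 2

theorem nrm_dbl (z : ℤ × ℤ) : nrm (dbl z) = 2 * nrm z := by
  simp only [nrm, dbl]; ring

theorem nrm_nonneg (z : ℤ × ℤ) : 0 ≤ nrm z := by unfold nrm; positivity

theorem nrm_eq_zero {z : ℤ × ℤ} : nrm z = 0 ↔ z = 0 := by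
  constructor
  · intro h
    unfold nrm at h
    ext
    · simp only [Prod.fst_zero]; nlinarith [sq_nonneg z.1, sq_nonneg z.2]
    · simp only [Prod.snd_zero]; nlinarith [sq_nonneg z.1, sq_nonneg z.2]
  · rintro rfl; rfl

theorem nrm_dbl_iterate (n : ℕ) (z : ℤ × ℤ) : nrm (dbl^[n] z) = 2 ^ n * nrm z := by
  induction n with
  | zero => simp
  | succ n ih => rw [Function.iterate_succ_apply', nrm_dbl, ih]; ring

theorem eq_zero_of_nrm_lt {n : ℕ} {z : ℤ × ℤ} (h : nrm (dbl^[n] z) < 2 ^ n) : z = 0 := by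
  rw [nrm_dbl_iterate] at h
  rw [← nrm_eq_zero]
  have h1 : nrm z < 1 := by
    by_contra h2
    push Not at h2
    have : (0 : ℤ) < 2 ^ n := by positivity
    nlinarith
  linarith [nrm_nonneg z]

theorem dbl_iterate_zero (n : ℕ) : dbl^[n] 0 = 0 := Function.iterate_fixed dbl_zero n

theorem eq_zero_of_forall_dbl {z : ℤ × ℤ} (h : ∀ n : ℕ, ∃ w, dbl^[n] w = z) : z = 0 := by
  obtain ⟨w, hw⟩ := h (nrm z).toNat
  have : nrm z < 2 ^ (nrm z).toNat := by
    have h1 : (nrm z).toNat < 2 ^ (nrm z).toNat := Nat.lt_two_pow_self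
    have h2 := Int.toNat_of_nonneg (nrm_nonneg z)
    calc nrm z = ((nrm z).toNat : ℤ) := h2.symm
      _ < ((2 ^ (nrm z).toNat : ℕ) : ℤ) := by exact_mod_cast h1
      _ = _ := by push_cast; rfl
  rw [← hw] at this ⊢
  rw [hw] at this
  have h3 : w = 0 := eq_zero_of_nrm_lt (n := (nrm z).toNat) (by rw [hw]; exact this)
  rw [h3, dbl_iterate_zero]

/-- A nonzero vertex has a `(1 + i)`-adic valuation. -/
theorem exists_odd_part {z : ℤ × ℤ} (h : z ≠ 0) :
    ∃ n w, (w.1 + w.2) % 2 = 1 ∧ dbl^[n] w = z := by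
  by_contra hc
  push Not at hc
  refine h (eq_zero_of_forall_dbl fun n => ?_)
  induction n with
  | zero => exact ⟨z, rfl⟩
  | succ n ih =>
    obtain ⟨w, hw⟩ := ih
    rcases Int.emod_two_eq (w.1 + w.2) with h0 | h0
    · exact ⟨half w, by rw [Function.iterate_succ_apply, dbl_half h0, hw]⟩
    · exact absurd hw (hc n w h0)

theorem odd_part_unique {n m : ℕ} {z w : ℤ × ℤ} (hz : (z.1 + z.2) % 2 = 1)
    (hw : (w.1 + w.2) % 2 = 1) (h : dbl^[n] z = dbl^[m] w) : n = m ∧ z = w := by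
  induction n generalizing m with
  | zero =>
    cases m with
    | zero => exact ⟨rfl, h⟩
    | succ m =>
      rw [Function.iterate_succ_apply'] at h
      have := dbl_even (dbl^[m] w)
      rw [← h] at this
      simp only [Function.iterate_zero, id] at this
      omega
  | succ n ih =>
    cases m with
    | zero =>
      rw [Function.iterate_succ_apply'] at h
      have := dbl_even (dbl^[n] z)
      rw [h] at this
      simp only [Function.iterate_zero, id] at this
      omega
    | succ m =>
      rw [Function.iterate_succ_apply', Function.iterate_succ_apply'] at h
      obtain ⟨h1, h2⟩ := ih (dbl_injective h)
      exact ⟨by rw [h1], h2⟩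

/-- `Folds` prescribes the sign of each nonzero vertex once, by uniqueness of the odd part, and
leaves the centre free. -/
theorem exists_folds (A : ℕ → ℤˣ) (k : ℤ) (ε : ℤˣ) : ∃ T, Folds A k T ∧ T 0 = ε := by
  classical
  let P : ℤ × ℤ → ℕ × (ℤ × ℤ) → Prop := fun z r => (r.2.1 + r.2.2) % 2 = 1 ∧ dbl^[r.1] r.2 = z
  refine ⟨fun z => if h : ∃ r, P z r then
    A h.choose.1 * sgn (h.choose.2.1 + typeSeq A k h.choose.1) else ε, ?_, ?_⟩
  · intro n z hz
    have h : ∃ r, P (dbl^[n] z) r := ⟨(n, z), hz, rfl⟩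
    obtain ⟨h1, h2⟩ := odd_part_unique h.choose_spec.1 hz h.choose_spec.2
    simp only [dif_pos h]
    rw [h1, h2]
  · have h : ¬ ∃ r, P 0 r := by
      rintro ⟨⟨n, z⟩, h1, h2⟩
      have : z = 0 := eq_zero_of_nrm_lt (n := n) (by
        simp only at h2
        rw [h2]; simp [nrm])
      rw [this] at h1
      simp at h1
    simp only [dif_neg h]

end Paperfolding

/-! ### The derived covering and its curves. -/

namespace Paperfolding

open DEdge

/-- The parent of an edge with even source: the first half of the bent edge. -/
def parEven (T : ℤ × ℤ → ℤˣ) (s : DEdge) : DEdge :=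
  ⟨(s.x + s.y) / 2, (s.y - s.x) / 2, if T s.tgt = 1 then s.p else s.q,
    if T s.tgt = 1 then s.q else -s.p⟩

/-- The parent of an edge: the edge of the derived covering that the edge is a half of. -/
def par (T : ℤ × ℤ → ℤˣ) (s : DEdge) : DEdge :=
  if (s.x + s.y) % 2 = 0 then parEven T s else parEven T ((next T).symm s)

/-- The turns of the derived covering. -/
abbrev der (T : ℤ × ℤ → ℤˣ) : ℤ × ℤ → ℤˣ := fun z => T (dbl z)

variable {A : ℕ → ℤˣ} {k : ℤ} {T : ℤ × ℤ → ℤˣ} {s s' : DEdge}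

theorem par_of_even (h : (s.x + s.y) % 2 = 0) : par T s = parEven T s := if_pos h

theorem Compat.odd_dir (h : s.Compat k) : (s.p + s.q) % 2 = 1 := unit_odd h.1

theorem src_next_odd (hs : s.Compat k) (h : (s.x + s.y) % 2 = 0) :
    ((next T s).x + (next T s).y) % 2 = 1 := by
  have := Compat.odd_dir hs
  simp only [next_apply]; omega

theorem src_next_even (hs : s.Compat k) (h : (s.x + s.y) % 2 = 1) :
    ((next T s).x + (next T s).y) % 2 = 0 := by
  have := Compat.odd_dir hs
  simp only [next_apply]; omega

theorem par_next_of_even (hs : s.Compat k) (h : (s.x + s.y) % 2 = 0) :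
    par T (next T s) = par T s := by
  have := src_next_odd (T := T) hs h
  rw [par, if_neg (by omega), Equiv.symm_apply_apply, par_of_even h]

theorem compat_prev : ((next T).symm s).Compat k ↔ s.Compat k := by
  rw [← compat_next (T := T), Equiv.apply_symm_apply]

theorem src_prev_even (hs : s.Compat k) (h : (s.x + s.y) % 2 = 1) :
    (((next T).symm s).x + ((next T).symm s).y) % 2 = 0 := by
  have := Compat.odd_dir hs
  rw [next_symm_apply]
  rcases units_cases (T s.src) with h | h <;> simp [h] <;> omega

theorem tgt_parEven (h : (s.x + s.y) % 2 = 0) : dbl (parEven T s).tgt = (next T s).tgt := by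
  simp only [parEven, next_apply]
  rcases units_cases (T s.tgt) with h1 | h1 <;> rw [h1] <;>
    simp [dbl, tgt, show ¬ ((-1 : ℤˣ) = 1) by decide] <;> omega

/-- The two odd vertices are separated by one horizontal and one vertical edge, so their abscissas
have opposite parities. -/
theorem turn_next_next (hF : Folds A k T) (hs : s.Compat k) (h : (s.x + s.y) % 2 = 0) :
    T (next T (next T s)).tgt = -T s.tgt := by
  have ho := Compat.odd_dir hs
  refine hF.odd_neg ?_ ?_ ?_ <;> simp only [tgt, next_apply]
  · omega
  all_goals
    generalize T (s.x + s.p, s.y + s.q) = t1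
    generalize T _ = t2
    rcases units_cases t1 with rfl | rfl <;> rcases units_cases t2 with rfl | rfl <;>
      simp <;> omega

/-- Up to a fixed similarity, a parent is its first half rotated by an eighth of a turn towards the
bend. The bends at the two odd vertices are opposite, so their effects cancel and only the turn at
the even vertex between them remains. -/
theorem parEven_next_next (hF : Folds A k T) (hs : s.Compat k) (h : (s.x + s.y) % 2 = 0) :
    parEven T (next T (next T s)) = next (der T) (parEven T s) := by
  have ho := Compat.odd_dir hs
  have ht := tgt_parEven (T := T) h
  have h3 := turn_next_next hF hs h
  have h4 : der T (parEven T s).tgt = T (next T s).tgt := by simp only [der, ht]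
  rw [parEven, next_apply (der T), h4, h3]
  generalize hu : T (next T s).tgt = u
  have e1 : next T (next T s) = ⟨(next T s).tgt.1, (next T s).tgt.2,
    -(u : ℤ) * (next T s).q, (u : ℤ) * (next T s).p⟩ := by rw [next_apply, hu]; rfl
  rw [e1]
  have e2 : (next T s).q = (T s.tgt : ℤ) * s.p := rfl
  have e3 : (next T s).p = -(T s.tgt : ℤ) * s.q := rfl
  rw [← ht, e2, e3]
  simp only [parEven]
  generalize T s.tgt = t
  simp only [dbl, tgt]
  rcases units_cases t with rfl | rfl <;> rcases units_cases u with rfl | rfl <;>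
    simp [show ¬ ((-1 : ℤˣ) = 1) by decide] <;> omega

theorem par_next_of_odd (hF : Folds A k T) (hs : s.Compat k) (h : (s.x + s.y) % 2 = 1) :
    par T (next T s) = next (der T) (par T s) := by
  have h1 := src_next_even (T := T) hs h
  rw [par_of_even h1, par, if_neg (by omega),
    ← parEven_next_next hF (compat_prev.2 hs) (src_prev_even hs h), Equiv.apply_symm_apply]

theorem tgt_par (hs : s.Compat k) (h : (s.x + s.y) % 2 = 1) :
    dbl (par T s).tgt = s.tgt := by
  rw [par, if_neg (by omega), tgt_parEven (src_prev_even hs h),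
    Equiv.apply_symm_apply]

/-- The bend is `A 0 * sgn s.x`, and the source of the parent has the parity of `s.x`. Hence
horizontal and vertical are exchanged according to that parity: the orientation is again a
chessboard, with type shifted when `A 0 = -1`. -/
theorem compat_parEven (hF : Folds A k T) (hs : s.Compat k) (h : (s.x + s.y) % 2 = 0) :
    (parEven T s).Compat (nextType (A 0) k) := by
  have ho := Compat.odd_dir hs
  obtain ⟨hu, hk⟩ := hs
  have h1 := hF.odd (z := s.tgt) (by simp only [tgt]; omega)
  simp only [parEven, Compat, h1, nextType]
  simp only [tgt, sgn]
  rcases units_cases (A 0) with h2 | h2 <;> rw [h2] <;> split_ifs <;>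
    simp_all [show ¬ ((-1 : ℤˣ) = 1) by decide] <;> omega

theorem compat_par (hF : Folds A k T) (hs : s.Compat k) :
    (par T s).Compat (nextType (A 0) k) := by
  rcases Int.emod_two_eq (s.x + s.y) with h | h
  · rw [par_of_even h]; exact compat_parEven hF hs h
  · rw [par, if_neg (by omega)]
    exact compat_parEven hF (compat_prev.2 hs) (src_prev_even hs h)

/-- Every edge of the derived covering has a first half. -/
theorem exists_par_eq (hF : Folds A k T) (hs : s.Compat (nextType (A 0) k)) :
    ∃ r : DEdge, r.Compat k ∧ (r.x + r.y) % 2 = 0 ∧ par T r = s := by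
  have ho := Compat.odd_dir hs
  obtain ⟨hu, hk⟩ := hs
  have key : ∀ r : DEdge, r.x = s.x - s.y → r.y = s.x + s.y → r.p ^ 2 + r.q ^ 2 = 1 →
      (r.p + k) % 2 = 0 → (∀ t, t = A 0 * sgn (r.x) → (if t = 1 then r.p else r.q) = s.p ∧
        (if t = 1 then r.q else -r.p) = s.q) →
      ∃ r : DEdge, r.Compat k ∧ (r.x + r.y) % 2 = 0 ∧ par T r = s := by
    intro r h1 h2 h3 h4 h5
    have h6 : (r.x + r.y) % 2 = 0 := by omega
    have h7 := unit_odd h3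
    refine ⟨r, ⟨h3, by omega⟩, h6, ?_⟩
    have h8 := hF.odd (z := r.tgt) (by simp only [tgt]; omega)
    have h9 : sgn (r.tgt.1 + k) = sgn r.x := sgn_congr (by simp only [tgt]; omega)
    rw [h9] at h8
    obtain ⟨h10, h11⟩ := h5 _ h8
    rw [par_of_even h6]
    ext <;> simp only [parEven]
    · omega
    · omega
    · exact h10
    · exact h11
  -- The bend of the first half depends only on its source, so it is known before its direction,
  -- which is then that of `s` or its rotation by a quarter turn.
  by_cases ht : A 0 * sgn (s.x - s.y) = 1
  · refine key ⟨s.x - s.y, s.x + s.y, s.p, s.q⟩ rfl rfl hu ?_ ?_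
    · simp only [nextType, sgn] at *
      rcases units_cases (A 0) with h2 | h2 <;> rw [h2] at * <;> split_ifs at * <;>
        simp_all [show ¬ ((-1 : ℤˣ) = 1) by decide] <;> omega
    · rintro t rfl
      simp [ht]
  · refine key ⟨s.x - s.y, s.x + s.y, -s.q, s.p⟩ rfl rfl (by simp only []; linarith) ?_ ?_
    · have hm : ¬ ((-1 : ℤˣ) = 1) := by decide
      rcases units_cases (A 0) with h2 | h2 <;> by_cases h3 : (s.x - s.y) % 2 = 0 <;>
        simp only [nextType, sgn, h2, h3, hm, if_true, if_false, mul_one, one_mul, neg_mul_neg,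
          not_true] at ht hk <;> simp only [] <;> omega
    · rintro t rfl
      simp [ht]

theorem parEven_injective (hF : Folds A k T) (hs : s.Compat k) (hs' : s'.Compat k)
    (h : (s.x + s.y) % 2 = 0) (h' : (s'.x + s'.y) % 2 = 0) (he : parEven T s = parEven T s') :
    s = s' := by
  have ho := Compat.odd_dir hs
  have ho' := Compat.odd_dir hs'
  obtain ⟨hu, hk⟩ := hs
  obtain ⟨hu', hk'⟩ := hs'
  have h1 := hF.odd (z := s.tgt) (by simp only [tgt]; omega)
  have h2 := hF.odd (z := s'.tgt) (by simp only [tgt]; omega)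
  rw [parEven, parEven, DEdge.mk.injEq] at he
  obtain ⟨e1, e2, e3, e4⟩ := he
  have ex : s.x = s'.x := by omega
  have ey : s.y = s'.y := by omega
  have e5 : T s.tgt = T s'.tgt := by
    rw [h1, h2]
    exact congrArg _ (sgn_congr (by simp only [tgt]; omega))
  rw [e5] at e3 e4
  split_ifs at e3 e4
  · ext <;> assumption
  · ext
    · exact ex
    · exact ey
    · omega
    · exact e3

theorem par_eq_cases (hF : Folds A k T) (hs : s.Compat k) (hs' : s'.Compat k)
    (he : par T s = par T s') : s' = s ∨ s' = next T s ∨ s = next T s' := by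
  rcases Int.emod_two_eq (s.x + s.y) with h | h <;>
    rcases Int.emod_two_eq (s'.x + s'.y) with h' | h'
  · rw [par_of_even h, par_of_even h'] at he
    exact Or.inl (parEven_injective hF hs hs' h h' he).symm
  · rw [par_of_even h, par, if_neg (by omega)] at he
    right; left
    rw [parEven_injective hF hs (compat_prev.2 hs') h (src_prev_even hs' h') he,
      Equiv.apply_symm_apply]
  · rw [par_of_even h', par, if_neg (by omega)] at he
    right; right
    rw [← parEven_injective hF (compat_prev.2 hs) hs' (src_prev_even hs h) h' he,
      Equiv.apply_symm_apply]
  · rw [par, par, if_neg (by omega), if_neg (by omega)] at he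
    exact Or.inl ((next T).symm.injective (parEven_injective hF (compat_prev.2 hs)
      (compat_prev.2 hs') (src_prev_even hs h) (src_prev_even hs' h') he)).symm

/-- The parent advances only when a step leaves a second half, that is, an edge with odd source. The
exact count makes the inductions on path length terminate. -/
theorem exists_par_pow (hF : Folds A k T) (hs : s.Compat k) (n : ℕ) :
    ∃ m : ℕ, par T ((next T ^ n) s) = (next (der T) ^ m) (par T s) ∧
      ((((next T ^ n) s).x + ((next T ^ n) s).y) % 2 = (s.x + s.y + n) % 2) ∧
      ((s.x + s.y) % 2 = 0 → m = n / 2) ∧ ((s.x + s.y) % 2 = 1 → m = (n + 1) / 2) := by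
  induction n with
  | zero => exact ⟨0, by simp⟩
  | succ n ih =>
    obtain ⟨m, h3, h5, h6, h7⟩ := ih
    have hc : ((next T ^ n) s).Compat k := compat_sameCycle ⟨n, rfl⟩ hs
    rw [pow_succ', Equiv.Perm.mul_apply]
    rcases Int.emod_two_eq (((next T ^ n) s).x + ((next T ^ n) s).y) with h | h
    · have hn := src_next_odd (T := T) hc h
      refine ⟨m, ?_, by omega, by omega, by omega⟩
      rw [par_next_of_even hc h, h3]
    · have hn := src_next_even (T := T) hc h
      refine ⟨m + 1, ?_, by omega, by omega, by omega⟩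
      rw [par_next_of_odd hF hc h, h3, pow_succ' _ m, Equiv.Perm.mul_apply]

theorem sameCycle_par (hF : Folds A k T) (hs : s.Compat k) (h : (next T).SameCycle s s') :
    (next (der T)).SameCycle (par T s) (par T s') := by
  have key : ∀ (n : ℕ) {s s' : DEdge}, s.Compat k → (next T ^ n) s = s' →
      (next (der T)).SameCycle (par T s) (par T s') := by
    rintro n s _ hs rfl
    obtain ⟨m, h3, -⟩ := exists_par_pow hF hs n
    exact ⟨m, by rw [h3]; rfl⟩
  obtain ⟨n, hn⟩ := h
  rcases Int.eq_nat_or_neg n with ⟨n, rfl | rfl⟩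
  · exact key n hs hn
  · refine (key n (compat_sameCycle ⟨_, hn⟩ hs) (s' := s) ?_).symm
    rw [← hn, ← zpow_natCast, ← Equiv.Perm.mul_apply, ← zpow_add]
    simp

/-- Moving `2 * n` steps moves the parent `n` steps; the edge reached then has the same parent as
`s'`, so it is at most one step away. -/
theorem sameCycle_of_par (hF : Folds A k T) (hs : s.Compat k) (hs' : s'.Compat k)
    (h : (next (der T)).SameCycle (par T s) (par T s')) : (next T).SameCycle s s' := by
  have key : ∀ (n : ℕ) {s s' : DEdge}, s.Compat k → s'.Compat k →
      (next (der T) ^ n) (par T s) = par T s' → (next T).SameCycle s s' := by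
    intro n s s' hs hs' h
    obtain ⟨j, hj⟩ : ∃ j : ℕ, par T ((next T ^ j) s) = par T s' := by
      rcases Int.emod_two_eq (s.x + s.y) with h0 | h0
      · obtain ⟨m, h3, -, h6, -⟩ := exists_par_pow hF hs (2 * n)
        refine ⟨2 * n, ?_⟩
        rw [h3, ← h, h6 h0]; congr 2; omega
      · obtain ⟨m, h3, -, -, h7⟩ := exists_par_pow hF hs (2 * n)
        refine ⟨2 * n, ?_⟩
        rw [h3, ← h, h7 h0]; congr 2; omega
    have h1 : (next T).SameCycle s ((next T ^ j) s) := ⟨j, by simp⟩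
    refine h1.trans ?_
    rcases par_eq_cases hF (compat_sameCycle h1 hs) hs' hj with h2 | h2 | h2
    · rw [h2]
    · rw [h2]; exact ⟨1, by simp⟩
    · rw [h2]; exact ⟨-1, by simp⟩
  obtain ⟨n, hn⟩ := h
  rcases Int.eq_nat_or_neg n with ⟨n, rfl | rfl⟩
  · exact key n hs hs' hn
  · refine (key n hs' hs ?_).symm
    rw [← hn, ← zpow_natCast, ← Equiv.Perm.mul_apply, ← zpow_add]
    simp

/-- There is no closed curve. -/
theorem pow_next_ne (n : ℕ) (hn : 0 < n) : ∀ {A : ℕ → ℤˣ} {k : ℤ} {T : ℤ × ℤ → ℤˣ} {s : DEdge},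
    Folds A k T → s.Compat k → (next T ^ n) s ≠ s := by
  induction n using Nat.strong_induction_on with
  | _ n ih =>
    intro A k T s hF hs he
    obtain ⟨m, h3, h5, h6, h7⟩ := exists_par_pow hF hs n
    rw [he] at h3 h5
    -- Parities of sources alternate, so a closed path has even length and `m = n / 2`.
    refine ih m (by omega) (by omega) hF.shift (compat_par hF hs) h3.symm

theorem zpow_next_injective (hF : Folds A k T) (hs : s.Compat k) :
    Function.Injective fun i : ℤ => (next T ^ i) s := by
  have key : ∀ i j : ℤ, i < j → (next T ^ i) s ≠ (next T ^ j) s := by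
    intro i j hij he
    refine pow_next_ne (j - i).toNat (by omega) hF (s := (next T ^ i) s) ((compat_zpow i).2 hs) ?_
    rw [← zpow_natCast, Int.toNat_of_nonneg (by omega), ← Equiv.Perm.mul_apply, ← zpow_add,
      sub_add_cancel]
    exact he.symm
  intro i j h
  rcases lt_trichotomy i j with h1 | h1 | h1
  · exact absurd h (key i j h1)
  · exact h1
  · exact absurd h.symm (key j i h1)

end Paperfolding

/-! ### Symmetry and interleaving of folding sequences. -/

namespace Paperfolding

open DEdge

section Sequences

/-- The symmetry of the `∞`-folding sequences: `a (2 ^ n + i) = - a (2 ^ n - i)`. -/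
def IsReflective (a : ℕ → ℤˣ) : Prop :=
  ∀ n i : ℕ, 0 < i → i < 2 ^ n → a (2 ^ n + i) = -a (2 ^ n - i)

theorem length_bar (S : List ℤˣ) : (bar S).length = S.length := by simp [bar]

theorem bar_bar (S : List ℤˣ) : bar (bar S) = S := by
  simp [bar]

theorem bar_append_cons (S S' : List ℤˣ) (ε : ℤˣ) :
    bar (S ++ ε :: S') = bar S' ++ -ε :: bar S := by simp [bar]

theorem IsNFolding.bar {n : ℕ} {S : List ℤˣ} (h : IsNFolding n S) : IsNFolding n (bar S) := by
  cases h with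
  | zero => exact IsNFolding.zero
  | succ ε h => rw [bar_append_cons, bar_bar]; exact IsNFolding.succ _ h

theorem IsNFolding.length {n : ℕ} {S : List ℤˣ} (h : IsNFolding n S) :
    S.length + 1 = 2 ^ n := by
  induction h with
  | zero => rfl
  | succ ε h ih => simp only [List.length_append, length_bar, List.length_cons, pow_succ]; omega

theorem IsInftyFolding.isReflective {a : ℕ → ℤˣ} (h : IsInftyFolding a) : IsReflective a := by
  intro n i hi hin
  have h1 := h (n + 1)
  generalize hm : n + 1 = m at h1
  generalize hL : (List.range (2 ^ m - 1)).map (fun i => a (i + 1)) = L at h1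
  cases h1 with
  | zero => omega
  | @succ n' S ε h1 =>
    obtain rfl : n = n' := by omega
    have hl := h1.length
    have hp : 2 ^ (n + 1) = 2 * 2 ^ n := pow_succ' 2 n
    have get : ∀ j (hj : j < 2 ^ (n + 1) - 1), a (j + 1) =
        (Paperfolding.bar S ++ ε :: S)[j]'(by
          simp only [List.length_append, length_bar, List.length_cons]; omega) := by
      intro j hj
      simp [← hL]
    have e1 := get (2 ^ n + i - 1) (by omega)
    have e2 := get (2 ^ n - i - 1) (by omega)
    rw [show 2 ^ n + i - 1 + 1 = 2 ^ n + i by omega,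
      List.getElem_append_right (by rw [length_bar]; omega)] at e1
    rw [show 2 ^ n - i - 1 + 1 = 2 ^ n - i by omega,
      List.getElem_append_left (by rw [length_bar]; omega)] at e2
    rw [e1, e2]
    have hb : (List.map (fun x => -x) S).reverse.length = S.length := by simp
    simp only [Paperfolding.bar, List.getElem_reverse, List.getElem_map, List.length_map,
      neg_neg, List.getElem_cons]
    rw [dif_neg (by omega)]
    congr 1
    omega

theorem IsReflective.isInftyFolding {a : ℕ → ℤˣ} (h : IsReflective a) : IsInftyFolding a := by
  intro n
  induction n with
  | zero => exact IsNFolding.zero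
  | succ n ih =>
    have hp : 2 ^ (n + 1) = 2 * 2 ^ n := pow_succ' 2 n
    have hpos : 0 < 2 ^ n := by positivity
    convert IsNFolding.succ (a (2 ^ n)) ih.bar using 1
    rw [bar_bar]
    apply List.ext_getElem
    · simp only [List.length_append, length_bar, List.length_cons, List.length_map,
        List.length_range]
      omega
    intro j h1 h2
    simp only [List.length_map, List.length_range] at h1
    simp only [List.getElem_map, List.getElem_range]
    rcases lt_trichotomy (j + 1) (2 ^ n) with hj | hj | hj
    · rw [List.getElem_append_left (by simp; omega)]
      simp
    · rw [List.getElem_append_right (by simp; omega)]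
      have : j - (2 ^ n - 1) = 0 := by omega
      simp [hj, this]
    · rw [List.getElem_append_right (by simp; omega)]
      simp only [List.length_map, List.length_range, List.getElem_cons]
      rw [dif_neg (by omega)]
      simp only [bar, List.getElem_reverse, List.getElem_map, List.length_map, List.length_range,
        List.getElem_range]
      have := h n (j + 1 - 2 ^ n) (by omega) (by omega)
      rw [show 2 ^ n + (j + 1 - 2 ^ n) = j + 1 by omega] at this
      rw [this]
      congr 2
      omega

theorem IsReflective.double {a : ℕ → ℤˣ} (h : IsReflective a) :
    IsReflective fun k => a (2 * k) := by
  intro n i h1 h2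
  have hp : 2 ^ (n + 1) = 2 * 2 ^ n := pow_succ' 2 n
  have := h (n + 1) (2 * i) (by omega) (by omega)
  simp only []
  rw [mul_add, Nat.mul_sub, ← hp, this]

/-- Reflect at the largest power of two not exceeding `k + 1`: if it equals `k + 1`, the two indices
are exchanged; otherwise they go to a smaller pair of the same kind. -/
theorem IsReflective.add_two {a : ℕ → ℤˣ} (h : IsReflective a) (k : ℕ) (hk : k % 2 = 1) :
    a (k + 2) = -a k := by
  induction k using Nat.strong_induction_on with
  | _ k ih =>
    obtain ⟨n, h1, h2⟩ : ∃ n, 2 ^ n ≤ k + 1 ∧ k + 1 < 2 * 2 ^ n :=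
      ⟨Nat.log 2 (k + 1), Nat.pow_log_le_self 2 (by omega), by
        rw [← pow_succ']; exact Nat.lt_pow_succ_log_self (by omega) _⟩
    have hp : n ≠ 0 := by rintro rfl; omega
    obtain ⟨n', rfl⟩ := Nat.exists_eq_succ_of_ne_zero hp
    have hpow : 2 ^ (n'.succ) = 2 * 2 ^ n' := pow_succ' 2 n'
    rcases Nat.lt_or_ge (k + 1) (2 ^ n'.succ + 1) with h3 | h3
    · have := h n'.succ 1 one_pos (by omega)
      rwa [show 2 ^ n'.succ + 1 = k + 2 by omega, show 2 ^ n'.succ - 1 = k by omega] at this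
    · have e1 := h n'.succ (k - 2 ^ n'.succ) (by omega) (by omega)
      have e2 := h n'.succ (k + 2 - 2 ^ n'.succ) (by omega) (by omega)
      rw [show 2 ^ n'.succ + (k - 2 ^ n'.succ) = k by omega] at e1
      rw [show 2 ^ n'.succ + (k + 2 - 2 ^ n'.succ) = k + 2 by omega] at e2
      have e3 := ih (2 ^ n'.succ - (k + 2 - 2 ^ n'.succ)) (by omega) (by omega)
      rw [show 2 ^ n'.succ - (k + 2 - 2 ^ n'.succ) + 2 =
        2 ^ n'.succ - (k - 2 ^ n'.succ) by omega] at e3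
      rw [e2, e1, e3, neg_neg]

theorem sgn_add_one (n : ℤ) : sgn (n + 1) = -sgn n := by
  rcases Int.emod_two_eq n with h | h
  · rw [sgn, sgn, if_neg (by omega), if_pos h]
  · rw [sgn, sgn, if_pos (by omega), if_neg (by omega), neg_neg]

theorem sgn_mul_self (n : ℤ) : sgn n * sgn n = 1 := Int.units_mul_self _

theorem sgn_add (m n : ℤ) : sgn (m + n) = sgn m * sgn n := by
  rcases Int.emod_two_eq n with h | h
  · rw [sgn_congr (show (m + n) % 2 = m % 2 by omega), sgn_congr (show n % 2 = 0 % 2 by omega)]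
    simp [sgn]
  · rw [sgn_congr (show (m + n) % 2 = (m + 1) % 2 by omega), sgn_add_one,
      sgn_congr (show n % 2 = 1 % 2 by omega)]
    simp [sgn]

theorem mul_sgn_mul_sgn_add (x : ℤˣ) (m n : ℤ) : x * sgn m * sgn (m + n) = x * sgn n := by
  rw [sgn_add, ← mul_assoc, mul_assoc x, sgn_mul_self, mul_one]

theorem eq_mul_sgn {f : ℤ → ℤˣ} (h : ∀ j, f (j + 1) = -f j) (j : ℤ) : f j = f 0 * sgn j := by
  induction j using Int.induction_on with
  | zero => simp [sgn]
  | succ i ih => rw [h, ih, sgn_add_one, mul_neg]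
  | pred i ih =>
    have e1 := h (-i - 1)
    have e2 := sgn_add_one (-i - 1)
    rw [sub_add_cancel] at e1 e2
    rw [← neg_neg (f _), ← e1, ih, e2, mul_neg, neg_neg]

/-- The terms of odd index alternate and the sequence `b` is made of the terms of even index. -/
def interleave (η : ℤˣ) (b : ℕ → ℤˣ) (k : ℕ) : ℤˣ :=
  if k % 2 = 0 then b (k / 2) else η * sgn (k / 2 : ℕ)

theorem interleave_even (η : ℤˣ) (b : ℕ → ℤˣ) (k : ℕ) : interleave η b (2 * k) = b k := by
  rw [interleave, if_pos (by omega)]; congr 1; omega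

theorem interleave_odd (η : ℤˣ) (b : ℕ → ℤˣ) (k : ℕ) :
    interleave η b (2 * k + 1) = η * sgn k := by
  rw [interleave, if_neg (by omega)]; congr 3; omega

/-- At odd indices, reflection pairs `2 * u + 1` with `2 * v + 1` where `u + v` is odd, so the
alternating terms are opposite. -/
theorem IsReflective.interleave {b : ℕ → ℤˣ} (h : IsReflective b) (η : ℤˣ) :
    IsReflective (interleave η b) := by
  intro n i h1 h2
  cases n with
  | zero => omega
  | succ n =>
    have hp : 2 ^ (n + 1) = 2 * 2 ^ n := pow_succ' 2 n
    obtain ⟨j, rfl | rfl⟩ := Nat.even_or_odd' i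
    · rw [hp, ← mul_add, ← Nat.mul_sub, interleave_even, interleave_even]
      exact h n j (by omega) (by omega)
    · rw [show 2 ^ (n + 1) + (2 * j + 1) = 2 * (2 ^ n + j) + 1 by omega,
        show 2 ^ (n + 1) - (2 * j + 1) = 2 * (2 ^ n - j - 1) + 1 by omega,
        interleave_odd, interleave_odd, ← mul_neg, ← sgn_add_one]
      congr 1
      apply sgn_congr
      omega

theorem IsReflective.isFiniteFolding {b : ℕ → ℤˣ} (h : IsReflective b) {p : ℕ} (hp : 1 ≤ p)
    {m : ℕ} {f : ℕ → ℤˣ} (hf : ∀ i < m, f i = b (p + i)) :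
    IsFiniteFolding ((List.range m).map f) := by
  refine ⟨p + m, _, h.isInftyFolding (p + m), ?_⟩
  have hlt : p + m < 2 ^ (p + m) := Nat.lt_two_pow_self
  set L := (List.range (2 ^ (p + m) - 1)).map (fun i => b (i + 1)) with hL
  have hLl : L.length = 2 ^ (p + m) - 1 := by simp [hL]
  have e : (List.range m).map f = (L.drop (p - 1)).take m := by
    apply List.ext_getElem
    · simp [hLl]; omega
    · intro j h1 h2
      simp only [List.length_map, List.length_range] at h1
      simp only [List.getElem_map, List.getElem_range, List.getElem_take, List.getElem_drop, hL]
      rw [hf j h1]; congr 1; omega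
  rw [e]
  exact (List.take_prefix _ _).isInfix.trans (List.drop_suffix _ _).isInfix

theorem twoSided_even (a : ℕ → ℤˣ) (ε : ℤˣ) (i : ℤ) :
    twoSided a ε (2 * i) = twoSided (fun k => a (2 * k)) ε i := by
  unfold twoSided
  rcases lt_trichotomy i 0 with h | h | h
  · rw [if_neg (by omega), if_neg (by omega), if_neg (by omega), if_neg (by omega)]
    congr 2; omega
  · simp [h]
  · rw [if_pos (by omega), if_pos h]
    congr 1; omega

theorem twoSided_nat (a : ℕ → ℤˣ) (ε : ℤˣ) {i : ℕ} (hi : 0 < i) : twoSided a ε i = a i := by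
  rw [twoSided, if_pos (by omega), Int.toNat_natCast]

theorem IsReflective.twoSided_odd {a : ℕ → ℤˣ} (h : IsReflective a) (ε : ℤˣ) (i : ℤ) :
    twoSided a ε (2 * i + 1) = a 1 * sgn i := by
  have key : ∀ j : ℤ, twoSided a ε (2 * (j + 1) + 1) = -twoSided a ε (2 * j + 1) := by
    intro j
    unfold twoSided
    rcases lt_trichotomy (2 * j + 2) 0 with h1 | h1 | h1
    · rw [if_neg (by omega), if_neg (by omega), if_neg (by omega), if_neg (by omega), neg_neg,
        ← h.add_two _ (by omega)]
      congr 1; omega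
    · rw [if_pos (by omega), if_neg (by omega), if_neg (by omega), neg_neg]
      congr 1; omega
    · rw [if_pos (by omega), if_pos (by omega), ← h.add_two _ (by omega)]
      congr 1; omega
  rw [eq_mul_sgn (f := fun j => twoSided a ε (2 * j + 1)) key]
  rfl

end Sequences

/-! ### Turns along the curves. -/

variable {A : ℕ → ℤˣ} {k : ℤ} {T : ℤ × ℤ → ℤˣ} {s s' : DEdge}

theorem zpow_next_add (i j : ℤ) (s : DEdge) :
    (next T ^ (i + j)) s = (next T ^ i) ((next T ^ j) s) := by
  rw [zpow_add, Equiv.Perm.mul_apply]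

theorem zpow_next_succ (i : ℤ) (s : DEdge) : (next T ^ (i + 1)) s = next T ((next T ^ i) s) := by
  rw [add_comm, zpow_next_add, zpow_one]

theorem zpow_next_next (i : ℤ) (s : DEdge) : (next T ^ i) (next T s) = (next T ^ (i + 1)) s := by
  rw [zpow_next_add, zpow_one]

theorem src_zpow_parity (hs : s.Compat k) (i : ℤ) :
    (((next T ^ i) s).x + ((next T ^ i) s).y) % 2 = (s.x + s.y + i) % 2 := by
  have step : ∀ r : DEdge, r.Compat k →
      ((next T r).x + (next T r).y) % 2 = (r.x + r.y + 1) % 2 := by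
    intro r hr
    rcases Int.emod_two_eq (r.x + r.y) with h | h
    · rw [src_next_odd hr h]; omega
    · rw [src_next_even hr h]; omega
  induction i using Int.induction_on with
  | zero => simp
  | succ i ih => rw [zpow_next_succ, step _ ((compat_zpow _).2 hs)]; omega
  | pred i ih =>
    have := step _ ((compat_zpow (T := T) (-i - 1)).2 hs)
    rw [← zpow_next_succ, sub_add_cancel] at this
    omega

theorem par_zpow (hF : Folds A k T) (hs : s.Compat k) (h : (s.x + s.y) % 2 = 1) (j : ℤ) :
    par T ((next T ^ (2 * j)) s) = (next (der T) ^ j) (par T s) := by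
  have key : ∀ n : ℕ, ∀ s : DEdge, s.Compat k → (s.x + s.y) % 2 = 1 →
      par T ((next T ^ (2 * n)) s) = (next (der T) ^ n) (par T s) := by
    intro n s hs h
    obtain ⟨m, h3, -, -, h7⟩ := exists_par_pow hF hs (2 * n)
    rw [h3, h7 h]; congr 2; omega
  rcases Int.eq_nat_or_neg j with ⟨n, rfl | rfl⟩
  · have := key n s hs h
    exact_mod_cast this
  · have := key n ((next T ^ (2 * (-n : ℤ))) s) ((compat_zpow _).2 hs)
      (by rw [src_zpow_parity hs]; omega)
    rw [← zpow_natCast, ← zpow_next_add] at this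
    rw [zpow_neg, Equiv.Perm.eq_inv_iff_eq, zpow_natCast, ← this]
    congr 1
    rw [show ((2 * n : ℕ) : ℤ) + 2 * -n = 0 by push_cast; ring]
    rfl

theorem turn_zpow_two (hF : Folds A k T) (hs : s.Compat k) (h : (s.x + s.y) % 2 = 0) (j : ℤ) :
    T ((next T ^ (2 * j)) s).tgt = T s.tgt * sgn j := by
  refine eq_mul_sgn (f := fun j => T ((next T ^ (2 * j)) s).tgt) (fun j => ?_) j
  rw [show 2 * (j + 1) = 2 * j + 1 + 1 by ring, zpow_next_succ, zpow_next_succ]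
  exact turn_next_next hF ((compat_zpow _).2 hs) (by rw [src_zpow_parity hs]; omega)

/-- The derived curve reads every second turn, the one made at an even vertex; the other turns
alternate by `turn_zpow_two`. -/
theorem turn_par_zpow (hF : Folds A k T) (hs : s.Compat k) (h : (s.x + s.y) % 2 = 1) (j : ℤ) :
    der T ((next (der T) ^ j) (par T s)).tgt = T ((next T ^ (2 * j)) s).tgt := by
  rw [← par_zpow hF hs h, der, tgt_par ((compat_zpow _).2 hs)
    (by rw [src_zpow_parity hs]; omega)]

theorem src_parity_of_tgt (hs : s.Compat k) : (s.x + s.y) % 2 = (s.tgt.1 + s.tgt.2 + 1) % 2 := by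
  have := Compat.odd_dir hs
  simp only [tgt]; omega

/-- The turns along a curve through the centre. -/
theorem turn_zpow_of_tgt_zero (n : ℕ) : ∀ {A : ℕ → ℤˣ} {k : ℤ} {T : ℤ × ℤ → ℤˣ} {s : DEdge}
    {a : ℕ → ℤˣ} (_ : IsReflective a) (_ : ∀ m, A m = a (2 ^ m)) (_ : Folds A k T)
    (_ : s.Compat k) (_ : s.tgt = 0) (i : ℤ) (_ : i.natAbs ≤ n),
    T ((next T ^ i) s).tgt = twoSided a (T 0) i := by
  induction n with
  | zero =>
    intro A k T s a ha hA hF hs h0 i hi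
    obtain rfl : i = 0 := by omega
    simp [h0, twoSided]
  | succ n ih =>
    intro A k T s a ha hA hF hs h0 i hi
    have hp : (s.x + s.y) % 2 = 1 := by rw [src_parity_of_tgt hs, h0]; simp
    have h0' : (par T s).tgt = 0 := dbl_injective (by rw [tgt_par hs hp, h0, dbl_zero])
    obtain ⟨j, rfl | rfl⟩ := Int.even_or_odd' i
    · rcases eq_or_ne j 0 with rfl | hj
      · simp [h0, twoSided]
      rw [← turn_par_zpow hF hs hp, twoSided_even]
      refine ih ha.double (fun m => ?_) hF.shift (compat_par hF hs) h0' j (by omega)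
      simp only [hA]; congr 1; ring
    · have h1 := compat_next (T := T).2 hs
      have h2 : (next T s).tgt = ((next T s).p, (next T s).q) := by
        have h3 : (next T s).x = 0 := congrArg Prod.fst h0
        have h4 : (next T s).y = 0 := congrArg Prod.snd h0
        simp [tgt, h3, h4]
      have h3 := Compat.odd_dir h1
      -- The vertex after the centre is `(p, q)` with `p` of the parity of `k`, so the sign in
      -- `Folds` is `+1`: index `1` carries `A 0` and not its opposite.
      have h5 : T (next T s).tgt = A 0 := by
        refine hF.odd_of_even (by rw [h2]; exact h3) ?_
        have := src_next_even (T := T) hs hp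
        rw [h2]
        have h6 := h1.2
        simp only []; omega
      rw [zpow_next_add, zpow_one, turn_zpow_two hF h1 (src_next_even hs hp), h5, hA,
        ha.twoSided_odd, pow_zero]

/-- The centre of a folding sequence is recognized from its terms of positive index. -/
theorem exists_dbl_eq_tgt (n : ℕ) : ∀ {A : ℕ → ℤˣ} {k : ℤ} {T : ℤ × ℤ → ℤˣ} {s : DEdge}
    {a : ℕ → ℤˣ} (_ : IsReflective a) (_ : Folds A k T) (_ : s.Compat k)
    (_ : ∀ i : ℕ, 0 < i → i ≤ 6 * 2 ^ n → T ((next T ^ i) s).tgt = a i),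
    ∃ z, dbl^[n] z = s.tgt := by
  induction n with
  | zero => intros; exact ⟨_, rfl⟩
  | succ n ih =>
    intro A k T s a ha hF hs h
    have hpow : 2 ^ (n + 1) = 2 * 2 ^ n := pow_succ' 2 n
    have hpos : 0 < 2 ^ n := by positivity
    rcases Int.emod_two_eq (s.x + s.y) with hp | hp
    -- With an odd target the turns of even index would alternate, so those of indices 2 and 6 would
    -- agree, whereas reflection at 4 gives `a 6 = -a 2`. This is the source of the factor 6.
    · exfalso
      have e1 := turn_zpow_two hF hs hp 1
      have e2 := turn_zpow_two hF hs hp 3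
      have e3 := h 2 (by omega) (by omega)
      have e4 := h 6 (by omega) (by omega)
      have e5 := ha 2 2 (by omega) (by omega)
      rw [show sgn 3 = sgn 1 from rfl, ← e1] at e2
      have e6 : a 6 = a 2 := by
        rw [← e3, ← e4]; exact e2
      rw [show 2 ^ 2 + 2 = 6 from rfl, show 2 ^ 2 - 2 = 2 from rfl, e6] at e5
      revert e5; generalize a 2 = t; revert t; decide
    · obtain ⟨z, hz⟩ := ih ha.double hF.shift (compat_par hF hs) (fun i h1 h2 => by
        have := turn_par_zpow hF hs hp i
        rw [zpow_natCast] at this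
        refine this.trans ?_
        have h3 := h (2 * i) (by omega) (by omega)
        rw [← h3]
        norm_cast)
      exact ⟨z, by rw [Function.iterate_succ_apply', hz, tgt_par hs hp]⟩

/-- Every other turn of the window alternates, and the rest form a shorter window on the derived
curve; `interleave` rebuilds a sequence from both. It depends on the window, since the curve may
avoid the centre. -/
theorem exists_isReflective_turn {a : ℕ → ℤˣ} (ha : IsReflective a) (m : ℕ) :
    ∀ {A : ℕ → ℤˣ} {k : ℤ} {T : ℤ × ℤ → ℤˣ} {s : DEdge}, Folds A k T → s.Compat k →
    ∃ b, IsReflective b ∧ ∃ p, 1 ≤ p ∧ ∀ i : ℕ, i < m → T ((next T ^ (i : ℤ)) s).tgt = b (p + i) := by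
  induction m using Nat.strong_induction_on with
  | _ m ih =>
    intro A k T s hF hs
    rcases Nat.lt_or_ge m 2 with hm | hm
    -- A single turn occurs in `a` itself, because `a 1` and `a 3` are opposite.
    · refine ⟨a, ha, ?_⟩
      have h3 := ha.add_two 1 rfl
      by_cases h : T s.tgt = a 1
      · refine ⟨1, le_rfl, fun i hi => ?_⟩
        obtain rfl : i = 0 := by omega
        exact h
      · refine ⟨3, by omega, fun i hi => ?_⟩
        obtain rfl : i = 0 := by omega
        refine Eq.trans ?_ h3.symm
        simp only [Nat.cast_zero, zpow_zero, Equiv.Perm.coe_one, id]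
        exact (Int.units_ne_iff_eq_neg).1 h
    rcases Int.emod_two_eq (s.x + s.y) with hp | hp
    · have h1 := compat_next (T := T).2 hs
      have hp1 := src_next_odd (T := T) hs hp
      obtain ⟨b, hb, p, hp0, hbp⟩ := ih (m / 2) (by omega) hF.shift (compat_par hF h1)
      refine ⟨interleave (T s.tgt * sgn (p - 1 : ℕ)) b, hb.interleave _, 2 * p - 1, by omega,
        fun i hi => ?_⟩
      obtain ⟨j, rfl | rfl⟩ := Nat.even_or_odd' i
      · rw [show 2 * p - 1 + 2 * j = 2 * (p - 1 + j) + 1 by omega, interleave_odd, Nat.cast_add,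
          mul_sgn_mul_sgn_add, ← turn_zpow_two hF hs hp]
        norm_cast
      · rw [show 2 * p - 1 + (2 * j + 1) = 2 * (p + j) by omega, interleave_even,
          ← hbp j (by omega)]
        refine Eq.trans ?_ (turn_par_zpow hF h1 hp1 j).symm
        rw [zpow_next_next]
        norm_cast
    · obtain ⟨b, hb, p, hp1, hbp⟩ := ih ((m + 1) / 2) (by omega) hF.shift (compat_par hF hs)
      refine ⟨interleave (T (next T s).tgt * sgn p) b, hb.interleave _, 2 * p, by omega,
        fun i hi => ?_⟩
      obtain ⟨j, rfl | rfl⟩ := Nat.even_or_odd' i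
      · rw [← mul_add, interleave_even, ← hbp j (by omega)]
        refine Eq.trans ?_ (turn_par_zpow hF hs hp j).symm
        norm_cast
      · rw [← add_assoc, ← mul_add, interleave_odd, Nat.cast_add p j, mul_sgn_mul_sgn_add,
          ← turn_zpow_two hF (compat_next.2 hs) (src_next_even hs hp), zpow_next_next]
        norm_cast

end Paperfolding

/-! ### Finite computations on doubled midpoints. -/

namespace Paperfolding

open DEdge

/-- The even endpoint of the edge with doubled midpoint `m`. -/
def evenEnd (m : ℤ × ℤ) : ℤ × ℤ :=
  if (m.1 / 2 + m.2 / 2) % 2 = 0 then (m.1 / 2, m.2 / 2) else (m.1 - m.1 / 2, m.2 - m.2 / 2)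

/-- The doubled midpoint of the parent of an edge, from its own doubled midpoint. -/
def parM (a : ℤˣ) (m : ℤ × ℤ) : ℤ × ℤ :=
  half (m.1 - (a * sgn (evenEnd m).1 : ℤˣ) * (m.2 - 2 * (evenEnd m).2),
    m.2 + (a * sgn (evenEnd m).1 : ℤˣ) * (m.1 - 2 * (evenEnd m).1))

/-- A half of the edge with doubled midpoint `m`, at its odd end if `b`. -/
def childM (b : Bool) (a : ℤˣ) (m : ℤ × ℤ) : ℤ × ℤ :=
  let v := if b then m - evenEnd m else evenEnd m
  let d := m - 2 * v
  2 * dbl v + if a * sgn (dbl v).1 = 1 then d else (-d.2, d.1)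

/-- Six derivations can collapse a whole disk to one edge. The nine lists are a certificate: for
each `μ` next to the centre and any six coefficients, one of them leads from `μ` through successive
halves to a suitable `c`. The offsets `e` are those of even coordinate sum and squared norm at most
5, the threshold of `nrm_descend`. -/
theorem exists_center_parM : ∀ μ ∈ [((1, 0) : ℤ × ℤ), (-1, 0), (0, 1), (0, -1)],
    ∀ a₀ a₁ a₂ a₃ a₄ a₅ : ℤˣ,
    ∃ c ∈ [[false, true, true, false, true, true], [false, true, false, true, true, true],
        [false, false, true, false, false, true], [true, true, true, true, true, false],
        [true, true, true, true, false, false], [true, true, true, false, true, true],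
        [true, true, true, false, true, false], [false, true, false, false, true, true],
        [false, true, false, false, true, false]].map
          (fun l => (l.zip [a₀, a₁, a₂, a₃, a₄, a₅]).foldr (fun r m => childM r.1 r.2 m) μ),
      (c.1 + c.2) % 2 = 1 ∧
      ∀ e ∈ [((0, 0) : ℤ × ℤ), (1, 1), (1, -1), (-1, 1), (-1, -1), (2, 0), (-2, 0), (0, 2), (0, -2)],
        parM a₅ (parM a₄ (parM a₃ (parM a₂ (parM a₁ (parM a₀ (c + e)))))) = μ := by
  decide +kernel

/-- The doubled midpoints of the four edges at distance one of the centre whose parents are again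
at distance one if the first coefficient is `a`. -/
def spiral (a : ℤˣ) : Finset (ℤ × ℤ) :=
  if a = 1 then {(1, 2), (-2, 1), (-1, -2), (2, -1)} else {(2, 1), (-1, 2), (-2, -1), (1, -2)}

/-- Together with `nrm_parM_of_mem_spiral` this is the dichotomy behind the count: the image
survives the next derivation if the next coefficient is `-a`, and falls onto the centre if it is
`a`. -/
theorem parM_mem_spiral : ∀ a : ℤˣ, ∀ m ∈ spiral a, parM a m ∈ spiral (-a) := by decide +kernel

theorem nrm_parM_of_mem_spiral : ∀ a : ℤˣ, ∀ m ∈ spiral (-a), nrm (parM a m) = 1 := by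
  decide +kernel

theorem exists_parM_eq : ∀ a : ℤˣ, ∀ m ∈ spiral (-a), ∃ m' ∈ spiral a, parM a m' = m := by
  decide +kernel

theorem parM_injOn_spiral : ∀ a : ℤˣ, ∀ m ∈ spiral a, ∀ m' ∈ spiral a,
    parM a m = parM a m' → m = m' := by
  decide +kernel

theorem nrm_of_mem_spiral : ∀ a : ℤˣ, ∀ m ∈ spiral a, nrm m = 5 ∧ (m.1 + m.2) % 2 = 1 := by
  decide +kernel

theorem card_spiral : ∀ a : ℤˣ, (spiral a).card = 4 := by decide +kernel

end Paperfolding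

/-! ### Descent of edges towards the centre. -/

namespace Paperfolding

open DEdge

variable {A : ℕ → ℤˣ} {k : ℤ} {T : ℤ × ℤ → ℤˣ} {s s' : DEdge}

theorem dbl_mid_parEven (h : (s.x + s.y) % 2 = 0) : dbl (parEven T s).mid =
    (s.mid.1 - (T s.tgt : ℤ) * s.q, s.mid.2 + (T s.tgt : ℤ) * s.p) := by
  simp only [parEven]
  generalize T s.tgt = t
  rcases units_cases t with rfl | rfl <;>
    simp [dbl, mid, show ¬ ((-1 : ℤˣ) = 1) by decide] <;> omega

theorem exists_dbl_mid_par (hs : s.Compat k) : ∃ e : ℤ × ℤ, e.1 ^ 2 + e.2 ^ 2 = 1 ∧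
    dbl (par T s).mid = s.mid + e := by
  rcases Int.emod_two_eq (s.x + s.y) with h | h
  · rw [par_of_even h, dbl_mid_parEven h]
    refine ⟨(-(T s.tgt : ℤ) * s.q, (T s.tgt : ℤ) * s.p), ?_, ?_⟩
    · have := hs.1
      rcases units_cases (T s.tgt) with h1 | h1 <;> simp [h1] <;> linarith
    · ext <;> simp [sub_eq_add_neg]
  · rw [par, if_neg (by omega)]
    obtain ⟨r, rfl⟩ := (next T).surjective s
    rw [Equiv.symm_apply_apply, dbl_mid_parEven (by
      have := src_prev_even (T := T) hs h; rwa [Equiv.symm_apply_apply] at this)]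
    refine ⟨(-r.p, -r.q), ?_, ?_⟩
    · have := (compat_next.1 hs).1
      simp only []; linarith
    · ext <;> simp only [mid, next_apply, Prod.fst_add, Prod.snd_add] <;> ring

theorem evenEnd_mid_of_even (hs : s.Compat k) (h : (s.x + s.y) % 2 = 0) :
    evenEnd s.mid = s.src := by
  rcases unit_cases hs.1 with ⟨h1, h2⟩ | ⟨h1, h2⟩ | ⟨h1, h2⟩ | ⟨h1, h2⟩ <;>
    simp only [evenEnd, mid, src, h1, h2] <;> split_ifs <;> ext <;> simp only [] <;> omega

theorem evenEnd_mid_of_odd (hs : s.Compat k) (h : (s.x + s.y) % 2 = 1) :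
    evenEnd s.mid = s.tgt := by
  rcases unit_cases hs.1 with ⟨h1, h2⟩ | ⟨h1, h2⟩ | ⟨h1, h2⟩ | ⟨h1, h2⟩ <;>
    simp only [evenEnd, mid, tgt, h1, h2] <;> split_ifs <;> ext <;> simp only [] <;> omega

/-- Expressed at the even end, the bend no longer involves `k`; hence `parM` needs only the
coefficient and the midpoint, and finite checks suffice. -/
theorem turn_tgt_of_even (hF : Folds A k T) (hs : s.Compat k) (h : (s.x + s.y) % 2 = 0) :
    T s.tgt = A 0 * sgn s.x := by
  have ho := Compat.odd_dir hs
  have hk := hs.2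
  rw [hF.odd (by simp only [tgt]; omega)]
  exact congrArg _ (sgn_congr (by simp only [tgt]; omega))

theorem mid_par (hF : Folds A k T) (hs : s.Compat k) : (par T s).mid = parM (A 0) s.mid := by
  rcases Int.emod_two_eq (s.x + s.y) with h | h
  · rw [par_of_even h, ← half_dbl (parEven T s).mid, dbl_mid_parEven h, parM,
      evenEnd_mid_of_even hs h, turn_tgt_of_even hF hs h]
    congr 1
    ext <;> simp [mid, src]
  · obtain ⟨r, rfl⟩ := (next T).surjective s
    have hr := compat_next.1 hs
    have hp := src_prev_even (T := T) hs h
    rw [par, if_neg (by omega)]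
    rw [Equiv.symm_apply_apply] at hp ⊢
    rw [← half_dbl (parEven T r).mid, dbl_mid_parEven hp, parM, evenEnd_mid_of_odd hs h]
    have ho := Compat.odd_dir hr
    have ht := turn_tgt_of_even hF hr hp
    have hx : sgn (next T r).tgt.1 = -sgn r.x := by
      rw [← sgn_add_one]
      apply sgn_congr
      simp only [tgt, next_apply]
      rcases units_cases (T (r.x + r.p, r.y + r.q)) with h1 | h1 <;> simp [h1] <;> omega
    rw [hx, mul_neg, ← ht]
    congr 1
    simp only [mid, next_apply, tgt]
    rcases units_cases (T (r.x + r.p, r.y + r.q)) with h1 | h1 <;> ext <;> simp [h1] <;> ring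

/-- If `c` is the coordinate of `x` along `e`, then `2 * nrm x' = nrm x + 2 * c + 1`. The term `2 *
c` is dominated by `c ^ 2` once `3 ≤ c`, and for `c ≤ 2` the norm drops as soon as `nrm x'` exceeds
5. -/
theorem nrm_descend {x x' e : ℤ × ℤ} (he : e.1 ^ 2 + e.2 ^ 2 = 1) (h : dbl x' = x + e) :
    nrm x' ≤ max 5 (nrm x - 1) := by
  have h1 := nrm_dbl x'
  rw [h] at h1
  have key : ∀ c d : ℤ, (c + 1) ^ 2 + d ^ 2 = 2 * nrm x' → nrm x = c ^ 2 + d ^ 2 →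
      nrm x' ≤ max 5 (nrm x - 1) := by
    intro c d h2 h3
    rw [le_max_iff]
    by_cases hc : 3 ≤ c
    · right; nlinarith [sq_nonneg d]
    · by_cases h4 : nrm x' ≤ 5
      · exact Or.inl h4
      · right
        have : 2 * nrm x' = nrm x + 2 * c + 1 := by rw [← h2, h3]; ring
        omega
  rcases unit_cases he with ⟨h2, h3⟩ | ⟨h2, h3⟩ | ⟨h2, h3⟩ | ⟨h2, h3⟩ <;>
    simp only [nrm, Prod.fst_add, Prod.snd_add, h2, h3] at h1 key
  · exact key x.1 x.2 (by linarith) rfl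
  · exact key (-x.1) x.2 (by linarith) (by ring)
  · exact key x.2 x.1 (by linarith) (by ring)
  · exact key (-x.2) x.1 (by linarith) (by ring)

/-- The type `k` allows one orientation on each unit interval, so edges may be replaced by
midpoints. -/
theorem compat_mid_injective (hs : s.Compat k) (hs' : s'.Compat k) (h : s.mid = s'.mid) :
    s = s' := by
  simp only [mid, Prod.mk.injEq] at h
  obtain ⟨h1, h2⟩ := h
  have e1 := hs.2
  have e2 := hs'.2
  rcases unit_cases hs.1 with ⟨h3, h4⟩ | ⟨h3, h4⟩ | ⟨h3, h4⟩ | ⟨h3, h4⟩ <;>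
    rcases unit_cases hs'.1 with ⟨h5, h6⟩ | ⟨h5, h6⟩ | ⟨h5, h6⟩ | ⟨h5, h6⟩ <;>
    ext <;> omega

theorem exists_compat_mid (k : ℤ) {m : ℤ × ℤ} (h : (m.1 + m.2) % 2 = 1) :
    ∃ s : DEdge, s.Compat k ∧ s.mid = m := by
  have key : ∀ p q : ℤ, p ^ 2 + q ^ 2 = 1 → (m.1 - p) % 2 = 0 → (m.2 - q) % 2 = 0 →
      ((m.1 - p) / 2 + (m.2 - q) / 2 + p + k) % 2 = 0 →
      ∃ s : DEdge, s.Compat k ∧ s.mid = m := by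
    intro p q h1 h2 h3 h4
    refine ⟨⟨(m.1 - p) / 2, (m.2 - q) / 2, p, q⟩, ⟨h1, h4⟩, ?_⟩
    ext <;> simp only [mid] <;> omega
  rcases Int.emod_two_eq m.1 with h1 | h1
  · by_cases h2 : (m.1 / 2 + (m.2 - 1) / 2 + k) % 2 = 0
    · exact key 0 1 (by norm_num) (by omega) (by omega) (by omega)
    · exact key 0 (-1) (by norm_num) (by omega) (by omega) (by omega)
  · by_cases h2 : ((m.1 - 1) / 2 + m.2 / 2 + 1 + k) % 2 = 0
    · exact key 1 0 (by norm_num) (by omega) (by omega) (by omega)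
    · exact key (-1) 0 (by norm_num) (by omega) (by omega) (by omega)

theorem mid_odd (hs : s.Compat k) : (s.mid.1 + s.mid.2) % 2 = 1 := by
  have := Compat.odd_dir hs
  simp only [mid]; omega

/-- This leaves only the norms 1 and 5 below 6. -/
theorem nrm_emod_four {m : ℤ × ℤ} (h : (m.1 + m.2) % 2 = 1) : nrm m % 4 = 1 := by
  obtain ⟨a, b⟩ := m
  simp only [nrm] at *
  rcases Int.emod_two_eq a with h1 | h1
  · obtain ⟨c, rfl⟩ : ∃ c, a = 2 * c := ⟨a / 2, by omega⟩
    obtain ⟨d, rfl⟩ : ∃ d, b = 2 * d + 1 := ⟨b / 2, by omega⟩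
    ring_nf; omega
  · obtain ⟨c, rfl⟩ : ∃ c, a = 2 * c + 1 := ⟨a / 2, by omega⟩
    obtain ⟨d, rfl⟩ : ∃ d, b = 2 * d := ⟨b / 2, by omega⟩
    ring_nf; omega

theorem mem_spiral_of_nrm_eq {m : ℤ × ℤ} (h : nrm m = 5) (a : ℤˣ) :
    m ∈ spiral a ∨ m ∈ spiral (-a) := by
  obtain ⟨c, d⟩ := m
  simp only [nrm] at h
  have h1 : c ≤ 2 := by nlinarith
  have h2 : -2 ≤ c := by nlinarith
  have h3 : d ≤ 2 := by nlinarith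
  have h4 : -2 ≤ d := by nlinarith
  rcases units_cases a with rfl | rfl <;> interval_cases c <;> interval_cases d <;>
    first | (exfalso; omega) | decide

theorem nrm_mid_cases (hs : s.Compat k) (a : ℤˣ) : nrm s.mid = 1 ∨ s.mid ∈ spiral a ∨
    s.mid ∈ spiral (-a) ∨ 6 ≤ nrm s.mid := by
  have h1 := nrm_emod_four (mid_odd hs)
  have h2 := nrm_nonneg s.mid
  by_cases h3 : nrm s.mid = 5
  · rcases mem_spiral_of_nrm_eq h3 a with h | h <;> tauto
  · have : nrm s.mid = 1 ∨ 6 ≤ nrm s.mid := by omega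
    tauto

theorem src_or_tgt_eq_zero (hs : s.Compat k) (h : nrm s.mid = 1) : s.src = 0 ∨ s.tgt = 0 := by
  have h1 := unit_cases h
  simp only [mid] at h1
  simp only [src, tgt, Prod.ext_iff, Prod.fst_zero, Prod.snd_zero]
  rcases unit_cases hs.1 with ⟨h3, h4⟩ | ⟨h3, h4⟩ | ⟨h3, h4⟩ | ⟨h3, h4⟩ <;> omega

theorem nrm_mid_of_src_eq_zero (hs : s.Compat k) (h : s.src = 0) : nrm s.mid = 1 := by
  have h1 : s.x = 0 := congrArg Prod.fst h
  have h2 : s.y = 0 := congrArg Prod.snd h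
  simpa [nrm, mid, h1, h2] using hs.1

theorem nrm_mid_par_le (hs : s.Compat k) : nrm (par T s).mid ≤ max 5 (nrm s.mid - 1) := by
  obtain ⟨e, he, h⟩ := exists_dbl_mid_par (T := T) hs
  exact nrm_descend he h

theorem even_of_src_eq_zero (h : s.src = 0) : (s.x + s.y) % 2 = 0 := by
  have h1 : s.x = 0 := congrArg Prod.fst h
  have h2 : s.y = 0 := congrArg Prod.snd h
  simp [h1, h2]

theorem src_par_eq_zero (h : s.src = 0) : (par T s).src = 0 := by
  have h1 : s.x = 0 := congrArg Prod.fst h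
  have h2 : s.y = 0 := congrArg Prod.snd h
  rw [par_of_even (even_of_src_eq_zero h)]
  simp [parEven, src, h1, h2]

theorem exists_par_eq_of_src_eq_zero (hF : Folds A k T) (hs : s.Compat (nextType (A 0) k))
    (h : s.src = 0) : ∃ r : DEdge, r.Compat k ∧ r.src = 0 ∧ par T r = s := by
  obtain ⟨r, h1, h2, rfl⟩ := exists_par_eq hF hs
  refine ⟨r, h1, ?_, rfl⟩
  rw [par_of_even h2] at h
  simp only [parEven, src, Prod.ext_iff, Prod.fst_zero, Prod.snd_zero] at h ⊢
  omega

/-- `s` lies on a curve through the centre. -/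
def IsCentral (k : ℤ) (T : ℤ × ℤ → ℤˣ) (s : DEdge) : Prop :=
  ∃ r : DEdge, r.Compat k ∧ (next T).SameCycle s r ∧ r.src = 0

theorem isCentral_of_nrm_eq_one (hs : s.Compat k) (h : nrm s.mid = 1) : IsCentral k T s := by
  rcases src_or_tgt_eq_zero hs h with h1 | h1
  · exact ⟨s, hs, Equiv.Perm.SameCycle.refl _ _, h1⟩
  · exact ⟨next T s, compat_next.2 hs, ⟨1, by simp⟩, h1⟩

theorem isCentral_of_par (hF : Folds A k T) (hs : s.Compat k)
    (h : IsCentral (nextType (A 0) k) (der T) (par T s)) : IsCentral k T s := by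
  obtain ⟨r', h1, h2, h3⟩ := h
  obtain ⟨r, h4, h5, rfl⟩ := exists_par_eq_of_src_eq_zero hF h1 h3
  exact ⟨r, h4, sameCycle_of_par hF hs h4 h2, h5⟩

theorem isCentral_of_mem_spiral_neg (hF : Folds A k T) (hs : s.Compat k)
    (h : s.mid ∈ spiral (-A 0)) : IsCentral k T s := by
  refine isCentral_of_par hF hs (isCentral_of_nrm_eq_one (compat_par hF hs) ?_)
  rw [mid_par hF hs, nrm_parM_of_mem_spiral _ _ h]

/-- While the coefficients alternate, the ancestors stay in the surviving spiral; the first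
repetition puts one in the other spiral, whose parents touch the centre. -/
theorem isCentral_of_mem_spiral (n : ℕ) : ∀ {A : ℕ → ℤˣ} {k : ℤ} {T : ℤ × ℤ → ℤˣ} {s : DEdge},
    Folds A k T → s.Compat k → A (n + 1) = A n → s.mid ∈ spiral (A 0) → IsCentral k T s := by
  induction n with
  | zero =>
    intro A k T s hF hs hA h
    refine isCentral_of_par hF hs (isCentral_of_mem_spiral_neg hF.shift (compat_par hF hs) ?_)
    simp only [zero_add, hA, mid_par hF hs]
    exact parM_mem_spiral _ _ h
  | succ n ih =>
    intro A k T s hF hs hA h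
    refine isCentral_of_par hF hs ?_
    have h1 := parM_mem_spiral _ _ h
    rw [← mid_par hF hs] at h1
    by_cases h2 : A 1 = A 0
    · refine isCentral_of_mem_spiral_neg hF.shift (compat_par hF hs) ?_
      simpa [h2] using h1
    · refine ih hF.shift (compat_par hF hs) hA ?_
      simpa [(Int.units_ne_iff_eq_neg).1 h2] using h1

/-- If the coefficients are not eventually alternating, then all curves pass through the centre. -/
theorem isCentral_of_not_alternating (n : ℕ) : ∀ {A : ℕ → ℤˣ} {k : ℤ} {T : ℤ × ℤ → ℤˣ} {s : DEdge},
    Folds A k T → s.Compat k → (∀ N, ∃ n, N ≤ n ∧ A (n + 1) = A n) → nrm s.mid ≤ n →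
    IsCentral k T s := by
  induction n with
  | zero =>
    intro A k T s hF hs hA hn
    have := nrm_emod_four (mid_odd hs)
    have := nrm_nonneg s.mid
    push_cast at hn; omega
  | succ n ih =>
    intro A k T s hF hs hA hn
    rcases nrm_mid_cases hs (A 0) with h | h | h | h
    · exact isCentral_of_nrm_eq_one hs h
    · obtain ⟨n, -, hn⟩ := hA 0
      exact isCentral_of_mem_spiral n hF hs hn h
    · exact isCentral_of_mem_spiral_neg hF hs h
    · refine isCentral_of_par hF hs (ih hF.shift (compat_par hF hs) (fun N => ?_) ?_)
      · obtain ⟨n, h1, h2⟩ := hA (N + 1)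
        obtain ⟨m, rfl⟩ : ∃ m, n = m + 1 := ⟨n - 1, by omega⟩
        exact ⟨m, by omega, h2⟩
      · have := nrm_mid_par_le (T := T) hs
        push_cast at hn
        omega

/-- The edges which represent the curves when the coefficients alternate. -/
def IsRep (A : ℕ → ℤˣ) (s : DEdge) : Prop :=
  s.src = 0 ∨ (s.mid ∈ spiral (A 0) ∧ ∀ n, A (n + 1) = -A n)

theorem isRep_par (hF : Folds A k T) (hs : s.Compat k) (h : IsRep A s) :
    IsRep (fun n => A (n + 1)) (par T s) := by
  rcases h with h | ⟨h1, h2⟩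
  · exact Or.inl (src_par_eq_zero h)
  · refine Or.inr ⟨?_, fun n => h2 (n + 1)⟩
    simp only [zero_add, h2 0, mid_par hF hs]
    exact parM_mem_spiral _ _ h1

theorem exists_isRep_par_eq (hF : Folds A k T) (hs : s.Compat (nextType (A 0) k))
    (hA : ∀ n, A (n + 1) = -A n) (h : IsRep (fun n => A (n + 1)) s) :
    ∃ r : DEdge, r.Compat k ∧ IsRep A r ∧ par T r = s := by
  rcases h with h | ⟨h1, -⟩
  · obtain ⟨r, h1, h2, h3⟩ := exists_par_eq_of_src_eq_zero hF hs h
    exact ⟨r, h1, Or.inl h2, h3⟩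
  · simp only [zero_add, hA 0] at h1
    obtain ⟨m, h2, h3⟩ := exists_parM_eq _ _ h1
    obtain ⟨r, h4, rfl⟩ := exists_compat_mid k (nrm_of_mem_spiral _ _ h2).2
    refine ⟨r, h4, Or.inr ⟨h2, hA⟩, compat_mid_injective (compat_par hF h4) hs ?_⟩
    rw [mid_par hF h4, h3]

/-- If the coefficients alternate, then each curve has a representative. -/
theorem exists_isRep (n : ℕ) : ∀ {A : ℕ → ℤˣ} {k : ℤ} {T : ℤ × ℤ → ℤˣ} {s : DEdge},
    Folds A k T → s.Compat k → (∀ n, A (n + 1) = -A n) → nrm s.mid ≤ n →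
    ∃ r : DEdge, r.Compat k ∧ IsRep A r ∧ (next T).SameCycle s r := by
  induction n with
  | zero =>
    intro A k T s hF hs hA hn
    have := nrm_emod_four (mid_odd hs)
    have := nrm_nonneg s.mid
    push_cast at hn; omega
  | succ n ih =>
    intro A k T s hF hs hA hn
    have central : IsCentral k T s → ∃ r : DEdge, r.Compat k ∧ IsRep A r ∧
        (next T).SameCycle s r := by
      rintro ⟨r, h1, h2, h3⟩
      exact ⟨r, h1, Or.inl h3, h2⟩
    rcases nrm_mid_cases hs (A 0) with h | h | h | h
    · exact central (isCentral_of_nrm_eq_one hs h)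
    · exact ⟨s, hs, Or.inr ⟨h, hA⟩, Equiv.Perm.SameCycle.refl _ _⟩
    · exact central (isCentral_of_mem_spiral_neg hF hs h)
    · obtain ⟨r', h1, h2, h3⟩ := ih hF.shift (compat_par hF hs) (fun n => hA (n + 1)) (by
        have := nrm_mid_par_le (T := T) hs
        push_cast at hn
        omega)
      obtain ⟨r, h4, h5, rfl⟩ := exists_isRep_par_eq hF h1 hA h2
      exact ⟨r, h4, h5, sameCycle_of_par hF hs h4 h3⟩

theorem IsRep.tgt_ne_zero (hs : s.Compat k) (h : IsRep A s) : s.tgt ≠ 0 := by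
  intro h0
  have h1 : s.x + s.p = 0 := congrArg Prod.fst h0
  have h2 : s.y + s.q = 0 := congrArg Prod.snd h0
  have hu := hs.1
  rcases h with h | ⟨h, -⟩
  · have h3 : s.x = 0 := congrArg Prod.fst h
    have h4 : s.y = 0 := congrArg Prod.snd h
    have h5 : s.p = 0 := by omega
    have h6 : s.q = 0 := by omega
    simp [h5, h6] at hu
  · have h3 := (nrm_of_mem_spiral _ _ h).1
    have h4 : s.p = -s.x := by omega
    have h5 : s.q = -s.y := by omega
    simp only [nrm, mid, h4, h5] at h3
    rw [h4, h5] at hu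
    nlinarith

/-- The two kinds of representatives stay apart because their parents keep norms 1 and 5; within
each kind the parent determines the edge. -/
theorem isRep_par_injective (hF : Folds A k T) (hs : s.Compat k) (hs' : s'.Compat k)
    (h : IsRep A s) (h' : IsRep A s') (he : par T s = par T s') : s = s' := by
  have hm := congrArg mid he
  rw [mid_par hF hs, mid_par hF hs'] at hm
  have key : ∀ {s s' : DEdge}, s.Compat k → s'.Compat k → s.src = 0 → s'.mid ∈ spiral (A 0) →
      parM (A 0) s.mid ≠ parM (A 0) s'.mid := by
    intro s s' hs hs' h h' he
    have h1 := (nrm_of_mem_spiral _ _ (parM_mem_spiral _ _ h')).1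
    rw [← he, ← mid_par hF hs, nrm_mid_of_src_eq_zero (compat_par hF hs) (src_par_eq_zero h)] at h1
    norm_num at h1
  rcases h with h | ⟨h, -⟩ <;> rcases h' with h' | ⟨h', -⟩
  · have h1 := even_of_src_eq_zero h
    have h2 := even_of_src_eq_zero h'
    rw [par_of_even h1, par_of_even h2] at he
    exact parEven_injective hF hs hs' h1 h2 he
  · exact absurd hm (key hs hs' h h')
  · exact absurd hm.symm (key hs' hs h' h)
  · exact compat_mid_injective hs hs' (parM_injOn_spiral _ _ h _ h' hm)

/-- From an even source the two edges would share their parent. From an odd source their parents are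
again consecutive and the norm of the common vertex is halved, which cannot go on since it is never
0. -/
theorem isRep_next_ne (n : ℕ) : ∀ {A : ℕ → ℤˣ} {k : ℤ} {T : ℤ × ℤ → ℤˣ} {s s' : DEdge},
    Folds A k T → s.Compat k → s'.Compat k → IsRep A s → IsRep A s' → nrm s.tgt ≤ n →
    next T s ≠ s' := by
  induction n with
  | zero =>
    intro A k T s s' hF hs hs' h h' hn _
    have := nrm_nonneg s.tgt
    exact h.tgt_ne_zero hs (nrm_eq_zero.1 (by push_cast at hn; omega))
  | succ n ih =>
    rintro A k T s _ hF hs hs' h h' hn rfl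
    have hc : (s.x + s.y) % 2 = 0 ∨ (s.x + s.y) % 2 = 1 := Int.emod_two_eq _
    rcases hc with hp | hp
    · have := isRep_par_injective hF hs hs' h h' (par_next_of_even hs hp).symm
      exact pow_next_ne 1 one_pos hF hs (by simpa using this.symm)
    · refine ih hF.shift (compat_par hF hs) (compat_par hF hs') (isRep_par hF hs h)
        (isRep_par hF hs' h') ?_ (par_next_of_odd hF hs hp).symm
      have h1 := nrm_dbl (par T s).tgt
      rw [tgt_par hs hp] at h1
      have h2 := nrm_nonneg (par T s).tgt
      have h3 : nrm s.tgt ≠ 0 := fun h0 => h.tgt_ne_zero hs (nrm_eq_zero.1 h0)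
      push_cast at hn
      omega

theorem isRep_pow_next_ne (n : ℕ) : ∀ {A : ℕ → ℤˣ} {k : ℤ} {T : ℤ × ℤ → ℤˣ} {s s' : DEdge},
    Folds A k T → s.Compat k → s'.Compat k → IsRep A s → IsRep A s' → s ≠ s' →
    (next T ^ n) s ≠ s' := by
  induction n using Nat.strong_induction_on with
  | _ n ih =>
    intro A k T s s' hF hs hs' h h' hne he
    rcases Nat.lt_or_ge n 2 with hn | hn
    · interval_cases n
      · exact hne he
      · exact isRep_next_ne (nrm s.tgt).toNat hF hs hs' h h' (by
          have := nrm_nonneg s.tgt; omega) he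
    · obtain ⟨m, h3, -, h6, h7⟩ := exists_par_pow hF hs n
      rw [he] at h3
      exact ih m (by omega) hF.shift (compat_par hF hs) (compat_par hF hs') (isRep_par hF hs h)
        (isRep_par hF hs' h') (fun h4 => hne (isRep_par_injective hF hs hs' h h' h4)) h3.symm

/-- Distinct representatives represent distinct curves. -/
theorem IsRep.eq_of_sameCycle (hF : Folds A k T) (hs : s.Compat k) (hs' : s'.Compat k)
    (h : IsRep A s) (h' : IsRep A s') (hc : (next T).SameCycle s s') : s = s' := by
  by_contra hne
  obtain ⟨n, hn⟩ := hc
  rcases Int.eq_nat_or_neg n with ⟨n, rfl | rfl⟩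
  · exact isRep_pow_next_ne n hF hs hs' h h' hne hn
  · refine isRep_pow_next_ne n hF hs' hs h' h (Ne.symm hne) ?_
    rw [← hn, ← zpow_natCast, ← zpow_next_add]
    simp

/-! ### Disks covered by a curve through the centre. -/

/-- The doubled midpoint of the `n`-th ancestor of an edge. -/
def parIter : ℕ → (ℕ → ℤˣ) → ℤ × ℤ → ℤ × ℤ
  | 0, _, m => m
  | n + 1, A, m => parIter n (fun i => A (i + 1)) (parM (A 0) m)

theorem sameCycle_of_parIter_eq (n : ℕ) : ∀ {A : ℕ → ℤˣ} {k : ℤ} {T : ℤ × ℤ → ℤˣ} {r s : DEdge},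
    Folds A k T → r.Compat k → s.Compat k → parIter n A s.mid = parIter n A r.mid →
    (next T).SameCycle r s := by
  induction n with
  | zero =>
    intro A k T r s hF hr hs h
    rw [compat_mid_injective hs hr h]
  | succ n ih =>
    intro A k T r s hF hr hs h
    rw [parIter, parIter, ← mid_par hF hr, ← mid_par hF hs] at h
    exact sameCycle_of_par hF hr hs (ih hF.shift (compat_par hF hr) (compat_par hF hs) h)

theorem nrm_parIter (n : ℕ) : ∀ {A : ℕ → ℤˣ} {k : ℤ} {T : ℤ × ℤ → ℤˣ} {r : DEdge},
    Folds A k T → r.Compat k → r.src = 0 → nrm (parIter n A r.mid) = 1 := by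
  induction n with
  | zero =>
    intro A k T r hF hr h
    exact nrm_mid_of_src_eq_zero hr h
  | succ n ih =>
    intro A k T r hF hr h
    rw [parIter, ← mid_par hF hr]
    exact ih hF.shift (compat_par hF hr) (src_par_eq_zero h)

theorem mem_of_nrm_le_five {m : ℤ × ℤ} (h : nrm m ≤ 5) (hm : (m.1 + m.2) % 2 = 0) :
    m ∈ [((0, 0) : ℤ × ℤ), (1, 1), (1, -1), (-1, 1), (-1, -1), (2, 0), (-2, 0), (0, 2),
      (0, -2)] := by
  obtain ⟨c, d⟩ := m
  simp only [nrm] at h hm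
  have h1 : c ≤ 2 := by nlinarith
  have h2 : -2 ≤ c := by nlinarith
  have h3 : d ≤ 2 := by nlinarith
  have h4 : -2 ≤ d := by nlinarith
  interval_cases c <;> interval_cases d <;> first | (exfalso; omega) | decide

/-- A curve through the centre covers large disks. -/
theorem exists_ball (n : ℕ) : ∀ {A : ℕ → ℤˣ} {k : ℤ} {T : ℤ × ℤ → ℤˣ} {r : DEdge},
    Folds A k T → r.Compat k → r.src = 0 →
    ∃ c : ℤ × ℤ, ∀ s : DEdge, s.Compat k → nrm (s.mid - c) ≤ 5 + n →
      (next T).SameCycle r s := by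
  induction n with
  | zero =>
    intro A k T r hF hr h0
    have hμ : parIter 6 A r.mid ∈ [((1, 0) : ℤ × ℤ), (-1, 0), (0, 1), (0, -1)] := by
      have := unit_cases (nrm_parIter 6 hF hr h0)
      simp only [List.mem_cons, Prod.ext_iff, List.not_mem_nil, or_false]
      omega
    obtain ⟨c, -, hc, h⟩ := exists_center_parM _ hμ (A 0) (A 1) (A 2) (A 3) (A 4) (A 5)
    refine ⟨c, fun s hs hn => sameCycle_of_parIter_eq 6 hF hr hs ?_⟩
    have h1 := h (s.mid - c) (mem_of_nrm_le_five (by simpa using hn) (by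
      have := mid_odd hs
      simp only [Prod.fst_sub, Prod.snd_sub]; omega))
    rw [add_sub_cancel] at h1
    exact h1
  | succ n ih =>
    intro A k T r hF hr h0
    obtain ⟨c, hc⟩ := ih hF.shift (compat_par hF hr) (src_par_eq_zero h0)
    -- Relative to the centres `dbl c` and `c`, `nrm_descend` gains one unit of squared radius per
    -- derivation.
    refine ⟨dbl c, fun s hs h => sameCycle_of_par hF hr hs (hc _ (compat_par hF hs) ?_)⟩
    obtain ⟨e, he, h1⟩ := exists_dbl_mid_par (T := T) hs
    have := nrm_descend (x := s.mid - dbl c) (x' := (par T s).mid - c) he (by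
      rw [sub_add_eq_add_sub, ← h1]
      ext <;> simp [dbl] <;> ring)
    push_cast at h
    omega

end Paperfolding

/-! ### From directed edges to segments, curves and coverings. -/

namespace Paperfolding

open DEdge

/-- The directed edge which carries a segment, with respect to the origin `O`. -/
def toEdge (O : ℤ × ℤ) (S : Segment) : DEdge :=
  ⟨S.source.1 - O.1, S.source.2 - O.2, S.dir.1, S.dir.2⟩

/-- The covering with turns `T` at the vertices and orientations of type `k`. -/
def cover (O : ℤ × ℤ) (k : ℤ) (T : ℤ × ℤ → ℤˣ) : Set Segment :=
  {S | (toEdge O S).Compat k ∧ S.bendSource = T (toEdge O S).src ∧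
    S.bendTarget = T (toEdge O S).tgt}

variable {A : ℕ → ℤˣ} {O : ℤ × ℤ} {k : ℤ} {T : ℤ × ℤ → ℤˣ} {s s' : DEdge} {S S' : Segment}

theorem src_toEdge (O : ℤ × ℤ) (S : Segment) : (toEdge O S).src = S.source - O := rfl

theorem tgt_toEdge (O : ℤ × ℤ) (S : Segment) : (toEdge O S).tgt = S.target - O := by
  ext <;> simp [toEdge, tgt, Segment.dir]

theorem dir_unit (S : Segment) : S.dir.1 ^ 2 + S.dir.2 ^ 2 = 1 := S.unit_length

theorem eq_of_toEdge_eq (hS : S ∈ cover O k T) (hS' : S' ∈ cover O k T)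
    (h : toEdge O S = toEdge O S') : S = S' := by
  have h1 : S.source = S'.source := by
    have := congrArg src h
    rwa [src_toEdge, src_toEdge, sub_left_inj] at this
  have h2 : S.target = S'.target := by
    have := congrArg tgt h
    rwa [tgt_toEdge, tgt_toEdge, sub_left_inj] at this
  have h3 : S.bendSource = S'.bendSource := by rw [hS.2.1, hS'.2.1, h]
  have h4 : S.bendTarget = S'.bendTarget := by rw [hS.2.2, hS'.2.2, h]
  exact Segment.ext h1 h2 h3 h4

theorem exists_mem_cover (O : ℤ × ℤ) (T : ℤ × ℤ → ℤˣ) (hs : s.Compat k) :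
    ∃ S ∈ cover O k T, toEdge O S = s := by
  have h : toEdge O ⟨s.src + O, s.tgt + O, T s.src, T s.tgt, by simpa [src, tgt] using hs.1⟩ =
      s := by
    ext <;> simp [toEdge, src, tgt, Segment.dir]
  exact ⟨_, ⟨by rw [h]; exact hs, by rw [h], by rw [h]⟩, h⟩

/-- Two unit grid vectors with determinant `±1` differ by the corresponding quarter turn. -/
theorem Consecutive.toEdge_eq (h : Consecutive S S') : toEdge O S' =
    ⟨(toEdge O S).x + (toEdge O S).p, (toEdge O S).y + (toEdge O S).q,
      -(S.bendTarget : ℤ) * (toEdge O S).q, (S.bendTarget : ℤ) * (toEdge O S).p⟩ := by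
  obtain ⟨h1, h2, -⟩ := h
  have h3 := unit_cases (dir_unit S)
  have h4 := unit_cases (dir_unit S')
  have h5 : S.target = S.source + S.dir := by simp [Segment.dir]
  simp only [toEdge, h1, h5, turn] at *
  rcases units_cases S.bendTarget with h6 | h6 <;> rw [h6] at h2 ⊢ <;>
    rcases h3 with ⟨e1, e2⟩ | ⟨e1, e2⟩ | ⟨e1, e2⟩ | ⟨e1, e2⟩ <;>
    rcases h4 with ⟨e3, e4⟩ | ⟨e3, e4⟩ | ⟨e3, e4⟩ | ⟨e3, e4⟩ <;>
    rw [e1, e2, e3, e4] at h2 <;> norm_num at h2 <;>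
    ext <;> simp [e1, e2, e3, e4] <;> ring

theorem Consecutive.toEdge_next (h : Consecutive S S') (hb : S.bendTarget = T (toEdge O S).tgt) :
    toEdge O S' = next T (toEdge O S) := by
  rw [h.toEdge_eq, next_apply, hb]

theorem consecutive_of_toEdge (hS : S ∈ cover O k T) (hS' : S' ∈ cover O k T)
    (h : toEdge O S' = next T (toEdge O S)) : Consecutive S S' := by
  have h1 : S'.source = S.target := by
    have := congrArg src h
    rwa [src_next, src_toEdge, tgt_toEdge, sub_left_inj] at this
  refine ⟨h1, ?_, ?_⟩
  · have hp : S'.dir.1 = -(T (toEdge O S).tgt : ℤ) * S.dir.2 := congrArg DEdge.p h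
    have hq : S'.dir.2 = (T (toEdge O S).tgt : ℤ) * S.dir.1 := congrArg DEdge.q h
    rw [turn, hp, hq, hS.2.2]
    linear_combination (T (toEdge O S).tgt : ℤ) * dir_unit S
  · rw [hS'.2.1, hS.2.2, h, src_next]

theorem consecutive_iff (hS : S ∈ cover O k T) (hS' : S' ∈ cover O k T) :
    Consecutive S S' ↔ toEdge O S' = next T (toEdge O S) :=
  ⟨fun h => h.toEdge_next hS.2.2, consecutive_of_toEdge hS hS'⟩

theorem turn_eq (h : Consecutive S S') (hS : S ∈ cover O k T) :
    turn S S' = (T (toEdge O S).tgt : ℤ) := by rw [h.2.1, hS.2.2]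

theorem mem_support_iff {X : ℤ × ℤ} : X ∈ S.support ↔
    X - O = (toEdge O S).src ∨ X - O = (toEdge O S).tgt := by
  rw [src_toEdge, tgt_toEdge, sub_left_inj, sub_left_inj, Segment.support, Sym2.mem_iff]

/-- Reversing an edge changes the parity of its source but not that of `p`, so it breaks `Compat`.
-/
theorem eq_of_support_eq (hS : S ∈ cover O k T) (hS' : S' ∈ cover O k T)
    (h : S.support = S'.support) : S = S' := by
  rw [Segment.support, Segment.support, Sym2.eq_iff] at h
  apply eq_of_toEdge_eq hS hS'
  rcases h with ⟨h1, h2⟩ | ⟨h1, h2⟩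
  · ext <;> simp [toEdge, Segment.dir, h1, h2]
  · exfalso
    have e1 := hS.1.2
    have e2 := hS'.1.2
    have e3 := unit_odd (dir_unit S)
    simp only [toEdge, Segment.dir, h1, h2, Prod.fst_sub, Prod.snd_sub] at e1 e2 e3
    omega

theorem existsUnique_support (O : ℤ × ℤ) (k : ℤ) (T : ℤ × ℤ → ℤˣ) {P Q : ℤ × ℤ}
    (h : (Q.1 - P.1) ^ 2 + (Q.2 - P.2) ^ 2 = 1) :
    ∃! S, S ∈ cover O k T ∧ S.support = s(P, Q) := by
  obtain ⟨S, hS, hP⟩ : ∃ S ∈ cover O k T, S.support = s(P, Q) := by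
    have ho := unit_odd h
    have hodd : (P.1 + Q.1 - 2 * O.1 + (P.2 + Q.2 - 2 * O.2)) % 2 = 1 := by omega
    obtain ⟨s, hs, hm⟩ := exists_compat_mid (m := (P.1 + Q.1 - 2 * O.1, P.2 + Q.2 - 2 * O.2)) k hodd
    obtain ⟨S, hS, rfl⟩ := exists_mem_cover O T hs
    refine ⟨S, hS, ?_⟩
    rw [Segment.support, Sym2.eq_iff]
    have hu := unit_cases (dir_unit S)
    have hv := unit_cases h
    clear hodd hs hS h ho
    simp only [mid, toEdge, Segment.dir, Prod.fst_sub, Prod.snd_sub, Prod.ext_iff] at hu hv hm ⊢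
    omega
  exact ⟨S, ⟨hS, hP⟩, fun S' h' => eq_of_support_eq h'.1 hS (h'.2.trans hP.symm)⟩

theorem tgt_ne_src (hs : s.Compat k) : s.tgt ≠ s.src := by
  intro h
  have h1 := congrArg Prod.fst h
  have h2 := congrArg Prod.snd h
  have h3 := Compat.odd_dir hs
  simp only [tgt, src] at h1 h2
  omega

theorem next_ne (hs : s.Compat k) : next T s ≠ s := fun h =>
  tgt_ne_src hs (by rw [← src_next T, h])

theorem sub_eq_tgt_of_mem (hS : S ∈ cover O k T) (hS' : S' ∈ cover O k T)
    (h : toEdge O S' = next T (toEdge O S)) {X : ℤ × ℤ} (hX : X ∈ S.support)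
    (hX' : X ∈ S'.support) : X - O = (toEdge O S).tgt := by
  have h1 : (toEdge O S').src = (toEdge O S).tgt := by rw [h, src_next]
  rw [mem_support_iff (O := O)] at hX hX'
  rcases hX with hX | hX
  · rcases hX' with hX' | hX'
    · rw [hX', h1]
    · exfalso
      have h2 := hX.symm.trans hX'
      simp only [src_toEdge, tgt_toEdge, sub_left_inj] at h1 h2
      have h3 : S = S' := eq_of_support_eq hS hS' (by
        rw [Segment.support, Segment.support, Sym2.eq_iff]
        exact Or.inr ⟨h2, h1.symm⟩)
      exact next_ne hS.1 (by rw [← h, h3])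
  · exact hX

/-- The segment that is joined to `S` at its endpoint `X`. -/
theorem exists_partner (hS : S ∈ cover O k T) {X : ℤ × ℤ} (hX : X ∈ S.support) :
    ∃ U ∈ cover O k T, (Consecutive S U ∨ Consecutive U S) ∧ X ∈ U.support ∧ U ≠ S ∧
      ∀ V ∈ cover O k T, X ∈ V.support → (Consecutive V U ∨ Consecutive U V) → V = S := by
  rw [mem_support_iff (O := O)] at hX
  rcases hX with hX | hX
  · obtain ⟨U, hU, hUe⟩ := exists_mem_cover O T (compat_prev (T := T).2 hS.1)
    have hU' : toEdge O S = next T (toEdge O U) := by rw [hUe, Equiv.apply_symm_apply]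
    have ht : (toEdge O U).tgt = X - O := by rw [hX, hU', src_next]
    have hXU : X ∈ U.support := (mem_support_iff (O := O)).2 (Or.inr ht.symm)
    refine ⟨U, hU, Or.inr (consecutive_of_toEdge hU hS hU'), hXU, ?_, ?_⟩
    · rintro rfl; exact next_ne hU.1 hU'.symm
    · intro V hV hXV hc
      rw [consecutive_iff hV hU, consecutive_iff hU hV, ← hU'] at hc
      rcases hc with hc | hc
      · exfalso
        have h1 := sub_eq_tgt_of_mem hV hU hc hXV hXU
        exact tgt_ne_src hU.1 (by rw [ht, h1, hc, src_next])
      · exact eq_of_toEdge_eq hV hS hc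
  · obtain ⟨U, hU, hU'⟩ := exists_mem_cover O T (compat_next (T := T).2 hS.1)
    have ht : (toEdge O U).src = X - O := by rw [hX, hU', src_next]
    have hXU : X ∈ U.support := (mem_support_iff (O := O)).2 (Or.inl ht.symm)
    refine ⟨U, hU, Or.inl (consecutive_of_toEdge hS hU hU'), hXU, ?_, ?_⟩
    · rintro rfl; exact next_ne hU.1 hU'.symm
    · intro V hV hXV hc
      rw [consecutive_iff hV hU, consecutive_iff hU hV] at hc
      rcases hc with hc | hc
      · exact eq_of_toEdge_eq hV hS ((next T).injective (hc.symm.trans hU'))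
      · exact absurd ((sub_eq_tgt_of_mem hU hV hc hXU hXV).symm.trans ht.symm) (tgt_ne_src hU.1)

theorem isCovering_cover (O : ℤ × ℤ) (k : ℤ) (T : ℤ × ℤ → ℤˣ) : IsCovering (cover O k T) := by
  refine ⟨fun P Q h => existsUnique_support O k T h, ?_⟩
  intro s hs t ht hne h1 h2 X hXs hXt
  obtain ⟨u, hu, hsu, hXu, hus, hu'⟩ := exists_partner hs hXs
  obtain ⟨w, hw, htw, hXw, hwt, hw'⟩ := exists_partner ht hXt
  refine ⟨u, hu, w, hw, hsu, htw, hXu, hXw, ?_⟩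
  have key : ∀ {x y : Segment}, x ∈ cover O k T → y ∈ cover O k T → x ≠ y →
      x.support ≠ y.support := fun hx hy hxy h => hxy (eq_of_support_eq hx hy h)
  have hut : u ≠ t := by rintro rfl; tauto
  have hsw : s ≠ w := by rintro rfl; tauto
  have huw : u ≠ w := by
    rintro rfl
    exact hne (hu' t ht hXt htw).symm
  simp only [List.nodup_cons, List.mem_cons, List.not_mem_nil, or_false, not_or, not_false_eq_true,
    List.nodup_nil, and_true]
  exact ⟨⟨key hs hu hus.symm, key hs ht hne, key hs hw hsw⟩, ⟨key hu ht hut, key hu hw huw⟩,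
    key ht hw hwt.symm⟩

/-- The curve of the covering which contains the edge `s`. -/
def curve (O : ℤ × ℤ) (k : ℤ) (T : ℤ × ℤ → ℤˣ) (s : DEdge) : Set Segment :=
  {S ∈ cover O k T | (next T).SameCycle s (toEdge O S)}

theorem toEdge_zpow {C : ℤ → Segment} (hC : ∀ i, Consecutive (C i) (C (i + 1)))
    (hE : ∀ i, C i ∈ cover O k T) (i : ℤ) : toEdge O (C i) = (next T ^ i) (toEdge O (C 0)) := by
  induction i using Int.induction_on with
  | zero => rfl
  | succ i ih => rw [(hC i).toEdge_next (hE i).2.2, ih, zpow_next_succ]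
  | pred i ih =>
    have := (hC (-i - 1)).toEdge_next (hE _).2.2
    rw [sub_add_cancel, ih, ← Equiv.symm_apply_eq] at this
    rw [← this, show -(i : ℤ) - 1 = -1 + -i by ring, zpow_next_add, zpow_neg_one]
    rfl

theorem range_eq_curve {C : ℤ → Segment} (hC : ∀ i, Consecutive (C i) (C (i + 1)))
    (hE : ∀ i, C i ∈ cover O k T) : Set.range C = curve O k T (toEdge O (C 0)) := by
  ext S
  constructor
  · rintro ⟨i, rfl⟩
    exact ⟨hE i, i, (toEdge_zpow hC hE i).symm⟩
  · rintro ⟨hS, i, hi⟩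
    exact ⟨i, eq_of_toEdge_eq (hE i) hS (by rw [toEdge_zpow hC hE, hi])⟩

theorem exists_completeCurve (hF : Folds A k T) (hs : s.Compat k) :
    ∃ C : ℤ → Segment, IsCompleteCurve C ∧ Set.range C = curve O k T s ∧
      (∀ i, C i ∈ cover O k T) ∧ toEdge O (C 0) = s := by
  choose C hC hCe using fun i : ℤ => exists_mem_cover O T ((compat_zpow (T := T) i).2 hs)
  have h0 : toEdge O (C 0) = s := hCe 0
  have h1 : ∀ i, Consecutive (C i) (C (i + 1)) := fun i =>
    consecutive_of_toEdge (hC i) (hC _) (by rw [hCe, hCe, zpow_next_succ])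
  refine ⟨C, ⟨h1, fun i j hij => ?_⟩, by rw [range_eq_curve h1 hC, h0], hC, h0⟩
  have h2 := eq_of_support_eq (hC i) (hC j) hij
  exact zpow_next_injective hF hs (by simp only []; rw [← hCe, ← hCe, h2])

theorem mem_curvesIn_cover (hF : Folds A k T) {K : Set Segment} :
    K ∈ curvesIn (cover O k T) ↔ ∃ s : DEdge, s.Compat k ∧ K = curve O k T s := by
  constructor
  · rintro ⟨hK, C, hC, rfl⟩
    have hE : ∀ i, C i ∈ cover O k T := fun i => hK ⟨i, rfl⟩
    exact ⟨_, (hE 0).1, range_eq_curve hC.1 hE⟩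
  · rintro ⟨s, hs, rfl⟩
    obtain ⟨C, h1, h2, -⟩ := exists_completeCurve (O := O) hF hs
    exact ⟨fun _ h => h.1, C, h1, h2⟩

theorem curve_eq_iff (hs : s.Compat k) : curve O k T s = curve O k T s' ↔
    (next T).SameCycle s s' := by
  constructor
  · intro h
    obtain ⟨S, hS, rfl⟩ := exists_mem_cover O T hs
    have h1 : S ∈ curve O k T (toEdge O S) := ⟨hS, Equiv.Perm.SameCycle.refl _ _⟩
    rw [h] at h1
    exact h1.2.symm
  · intro h
    ext S
    exact and_congr_right fun _ => ⟨fun h1 => h.symm.trans h1, fun h1 => h.trans h1⟩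

/-- The set of segments has no marked index; choosing an indexation amounts to choosing the edge `r`
of index 0. -/
theorem isCurveAssociated_curve_iff (hF : Folds A k T) (hs : s.Compat k) {f : ℤ → ℤˣ} :
    IsCurveAssociated (curve O k T s) f ↔
      ∃ r, (next T).SameCycle s r ∧ ∀ i : ℤ, T ((next T ^ i) r).tgt = f i := by
  constructor
  · rintro ⟨C, hC, hr, ha⟩
    have hE : ∀ i, C i ∈ curve O k T s := fun i => hr ▸ ⟨i, rfl⟩
    refine ⟨toEdge O (C 0), (hE 0).2, fun i => ?_⟩
    have h1 := ha i
    rw [turn_eq (hC.1 i) (hE i).1, toEdge_zpow hC.1 (fun i => (hE i).1)] at h1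
    exact Units.ext h1
  · rintro ⟨r, hr, h⟩
    obtain ⟨C, h1, h2, h3, h4⟩ := exists_completeCurve (O := O) hF (compat_sameCycle hr hs)
    refine ⟨C, h1, by rw [h2, (curve_eq_iff hs).2 hr], fun i => ?_⟩
    rw [turn_eq (h1.1 i) (h3 i), toEdge_zpow h1.1 h3, h4, h]

theorem isFoldingCurve_curve {a : ℕ → ℤˣ} (ha : IsReflective a) (hF : Folds A k T)
    (hs : s.Compat k) : IsFoldingCurve (curve O k T s) := by
  refine ⟨fun i => T ((next T ^ i) s).tgt, fun j m => ?_,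
    (isCurveAssociated_curve_iff hF hs).2 ⟨s, Equiv.Perm.SameCycle.refl _ _, fun _ => rfl⟩⟩
  obtain ⟨b, hb, p, hp, h⟩ := exists_isReflective_turn ha m hF ((compat_zpow (T := T) j).2 hs)
  -- In `IsCompleteFolding` the list `List.range m` is coerced to a list of integers in monadic
  -- form; this brings it back to a plain `map`.
  have e : ∀ f : ℤ → ℤˣ, List.map f (do let i ← List.range m; pure (i : ℤ)) =
      (List.range m).map (fun i : ℕ => f i) := by
    intro f
    simp [List.flatMap_assoc, List.map_eq_flatMap]
  rw [e]
  refine hb.isFiniteFolding hp fun i hi => ?_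
  rw [← h i hi, ← zpow_next_add, add_comm]

theorem isCoveringByFoldingCurves_cover {a : ℕ → ℤˣ} (ha : IsReflective a) (hF : Folds A k T) :
    IsCoveringByFoldingCurves (cover O k T) := by
  refine ⟨isCovering_cover O k T, ?_, ?_, ?_⟩
  · intro K hK
    obtain ⟨s, hs, rfl⟩ := (mem_curvesIn_cover hF).1 hK
    exact isFoldingCurve_curve ha hF hs
  · intro K hK K' hK' hne
    obtain ⟨s, hs, rfl⟩ := (mem_curvesIn_cover hF).1 hK
    obtain ⟨s', hs', rfl⟩ := (mem_curvesIn_cover hF).1 hK'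
    rw [Function.onFun, Set.disjoint_left]
    intro S h1 h2
    exact hne ((curve_eq_iff hs).2 (h1.2.trans h2.2.symm))
  · ext S
    constructor
    · rintro ⟨K, hK, hS⟩; exact hK.1 hS
    · intro hS
      exact ⟨curve O k T (toEdge O S), (mem_curvesIn_cover hF).2 ⟨_, hS.1, rfl⟩, hS,
        Equiv.Perm.SameCycle.refl _ _⟩

end Paperfolding

/-! ### Local isomorphism property. -/

namespace Paperfolding

open DEdge Filter

variable {A : ℕ → ℤˣ} {O : ℤ × ℤ} {k : ℤ} {T : ℤ × ℤ → ℤˣ} {s s' r : DEdge} {S S' : Segment}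

section LocalIsomorphism

theorem dbl_iterate_add (n : ℕ) (z w : ℤ × ℤ) : dbl^[n] (z + w) = dbl^[n] z + dbl^[n] w := by
  induction n with
  | zero => rfl
  | succ n ih =>
    rw [Function.iterate_succ_apply', Function.iterate_succ_apply', Function.iterate_succ_apply',
      ih]
    ext <;> simp only [dbl, Prod.fst_add, Prod.snd_add] <;> ring

/-- Since `(1 + i) ^ 8 = 16`, these powers are homotheties, which makes approximation
coordinatewise. -/
theorem dbl_iterate_eight_mul (q : ℕ) (w : ℤ × ℤ) :
    dbl^[8 * q] w = (16 ^ q * w.1, 16 ^ q * w.2) := by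
  induction q with
  | zero => simp
  | succ q ih =>
    rw [mul_add, mul_one, add_comm, Function.iterate_add_apply, ih]
    ext <;> simp only [Function.iterate_succ_apply, Function.iterate_zero, id, dbl] <;> ring

/-- Since `(1 + i) ^ 2 = 2 * i`, the odd part `z` changes by even coordinates only. -/
theorem Folds.add_iterate (hF : Folds A k T) {z w : ℤ × ℤ} {n M : ℕ} (hz : (z.1 + z.2) % 2 = 1)
    (hM : n + 2 ≤ M) : T (dbl^[n] z + dbl^[M] w) = T (dbl^[n] z) := by
  obtain ⟨j, rfl⟩ := Nat.exists_eq_add_of_le hM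
  rw [add_assoc, Function.iterate_add_apply, Function.iterate_add_apply, ← dbl_iterate_add,
    hF n _ hz]
  generalize dbl^[j] w = u
  simp only [Function.iterate_succ_apply, Function.iterate_zero, id, dbl]
  rw [hF n _ (by simp only [Prod.fst_add, Prod.snd_add]; omega)]
  exact congrArg _ (sgn_congr (by simp only [Prod.fst_add]; omega))

/-- The turn at a vertex is invariant under the translations of high valuation which preserve the
turn at the centre. -/
theorem Folds.eventually_turn_eq (hF : Folds A k T) (X : ℤ × ℤ) :
    ∀ᶠ M in atTop, ∀ w, T (dbl^[M] w) = T 0 → T (X + dbl^[M] w) = T X := by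
  by_cases hX : X = 0
  · refine Eventually.of_forall fun M w h => ?_
    rw [hX, zero_add, h]
  · obtain ⟨n, z, hz, rfl⟩ := exists_odd_part hX
    filter_upwards [eventually_ge_atTop (n + 2)] with M hM w _
    exact hF.add_iterate hz hM

theorem toEdge_translate (O v : ℤ × ℤ) (S : Segment) : toEdge O (S.translate v) =
    ⟨(toEdge O S).x + v.1, (toEdge O S).y + v.2, (toEdge O S).p, (toEdge O S).q⟩ := by
  ext <;> simp [toEdge, Segment.translate, Segment.dir] <;> ring

theorem translate_mem_cover_iff {v : ℤ × ℤ} (hv : (v.1 + v.2) % 2 = 0)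
    (h1 : T ((toEdge O S).src + v) = T (toEdge O S).src)
    (h2 : T ((toEdge O S).tgt + v) = T (toEdge O S).tgt) :
    S.translate v ∈ cover O k T ↔ S ∈ cover O k T := by
  have e1 : (toEdge O (S.translate v)).src = (toEdge O S).src + v := by
    rw [toEdge_translate]; rfl
  have e2 : (toEdge O (S.translate v)).tgt = (toEdge O S).tgt + v := by
    rw [toEdge_translate]; ext <;> simp [tgt] <;> ring
  have e3 : (toEdge O (S.translate v)).Compat k ↔ (toEdge O S).Compat k := by
    rw [toEdge_translate]
    simp only [Compat]
    exact and_congr_right fun _ => by omega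
  simp only [cover, Set.mem_ofPred_eq, e1, e2, e3, h1, h2]
  rfl

theorem localIsomorphismProperty_cover (hF : Folds A k T) :
    LocalIsomorphismProperty (cover O k T) := by
  intro F hFE hfin
  have h1 : ∀ᶠ M in atTop, ∀ S ∈ F, ∀ w, T (dbl^[M] w) = T 0 →
      T ((toEdge O S).src + dbl^[M] w) = T (toEdge O S).src ∧
      T ((toEdge O S).tgt + dbl^[M] w) = T (toEdge O S).tgt := by
    rw [eventually_all_finite hfin]
    intro S _
    filter_upwards [hF.eventually_turn_eq (toEdge O S).src,
      hF.eventually_turn_eq (toEdge O S).tgt] with M h h' w hw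
    exact ⟨h w hw, h' w hw⟩
  have h2 : ∀ᶠ B : ℝ in atTop, ∀ S ∈ F, |(S.source.1 : ℝ)| ≤ B ∧ |(S.source.2 : ℝ)| ≤ B ∧
      |(S.target.1 : ℝ)| ≤ B ∧ |(S.target.2 : ℝ)| ≤ B := by
    rw [eventually_all_finite hfin]
    intro S _
    exact (eventually_ge_atTop _).and ((eventually_ge_atTop _).and
      ((eventually_ge_atTop _).and (eventually_ge_atTop _)))
  obtain ⟨q₀, hq₀⟩ := eventually_atTop.1 h1
  obtain ⟨B, hB0, hB⟩ := ((eventually_ge_atTop 0).and h2).exists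
  set q := q₀ + 1 with hq
  have hT := hq₀ (8 * q) (by omega)
  -- `α` is the parity of the abscissa of `w` for which the turn at `16 ^ q * w` is that of the
  -- centre; the ordinate has parity `1 - α`, so that `w` is odd.
  obtain ⟨α, hα0, hα1, hα⟩ : ∃ α : ℤ, 0 ≤ α ∧ α ≤ 1 ∧
      A (8 * q) * sgn (α + typeSeq A k (8 * q)) = T 0 := by
    by_cases h : A (8 * q) * sgn (0 + typeSeq A k (8 * q)) = T 0
    · exact ⟨0, le_rfl, by norm_num, h⟩
    · refine ⟨1, by norm_num, le_rfl, ?_⟩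
      rw [add_comm, sgn_add_one, mul_neg]
      rw [zero_add] at h
      rw [(Int.units_ne_iff_eq_neg).1 h, neg_neg]
  have hD : (0 : ℝ) < 16 ^ q := by positivity
  -- Each coordinate of a translated endpoint is within `B + 2 * 16 ^ q` of that of `c`.
  refine ⟨2 * (B + 2 * 16 ^ q), by positivity, fun c => ?_⟩
  have approx : ∀ (x : ℝ) (ρ : ℤ), 0 ≤ ρ → ρ ≤ 1 →
      |((16 ^ q * (2 * ⌊x / (2 * 16 ^ q)⌋ + ρ) : ℤ) : ℝ) - x| ≤ 2 * 16 ^ q := by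
    intro x ρ h0 h1
    have e1 := Int.floor_le (x / (2 * 16 ^ q))
    have e2 := Int.lt_floor_add_one (x / (2 * 16 ^ q))
    rw [le_div_iff₀ (by positivity)] at e1
    rw [div_lt_iff₀ (by positivity)] at e2
    have h0' : (0 : ℝ) ≤ ρ := by exact_mod_cast h0
    have h1' : (ρ : ℝ) ≤ 1 := by exact_mod_cast h1
    push_cast
    rw [abs_le]
    constructor <;> nlinarith
  set w : ℤ × ℤ := (2 * ⌊c.1 / (2 * 16 ^ q)⌋ + α, 2 * ⌊c.2 / (2 * 16 ^ q)⌋ + (1 - α)) with hw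
  have hv := dbl_iterate_eight_mul q w
  have hTv : T (dbl^[8 * q] w) = T 0 := by
    rw [hF _ _ (by simp only [hw]; omega), ← hα]
    exact congrArg _ (sgn_congr (by simp only [hw]; omega))
  refine ⟨dbl^[8 * q] w, fun S hS => ⟨?_, ?_⟩⟩
  · refine (translate_mem_cover_iff ?_ (hT S hS w hTv).1 (hT S hS w hTv).2).2 (hFE hS)
    rw [show 8 * q = (8 * q₀ + 7) + 1 by omega, Function.iterate_succ_apply']
    exact dbl_even _
  · have a1 := approx c.1 α hα0 hα1
    have a2 := approx c.2 (1 - α) (by omega) (by omega)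
    have sq : ∀ x v c : ℝ, |x| ≤ B → |v - c| ≤ 2 * 16 ^ q →
        (x + v - c) ^ 2 ≤ (B + 2 * 16 ^ q) ^ 2 := by
      intro x v c h h'
      rw [abs_le] at h h'
      apply sq_le_sq'  <;> linarith
    have fin : ∀ Y : ℤ × ℤ, |(Y.1 : ℝ)| ≤ B → |(Y.2 : ℝ)| ≤ B →
        (((Y + dbl^[8 * q] w).1 : ℝ) - c.1) ^ 2 + (((Y + dbl^[8 * q] w).2 : ℝ) - c.2) ^ 2 ≤
          (2 * (B + 2 * 16 ^ q)) ^ 2 := by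
      intro Y h h'
      have b1 := sq _ _ _ h a1
      have b2 := sq _ _ _ h' a2
      rw [hv]
      simp only [Prod.fst_add, Prod.snd_add, hw, Int.cast_add (_ : ℤ)] at *
      nlinarith [sq_nonneg (B + 2 * 16 ^ q)]
    obtain ⟨b1, b2, b3, b4⟩ := hB S hS
    intro X hX
    rw [Segment.support, Sym2.mem_iff] at hX
    rcases hX with rfl | rfl
    · exact fin _ b1 b2
    · exact fin _ b3 b4

end LocalIsomorphism

/-! ### Uniqueness of the covering. -/

theorem Consecutive.translate (h : Consecutive S S') (v : ℤ × ℤ) :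
    Consecutive (S.translate v) (S'.translate v) := by
  obtain ⟨h1, h2, h3⟩ := h
  refine ⟨by simp [Segment.translate, h1], ?_, h3⟩
  rw [← show (S.translate v).bendTarget = S.bendTarget from rfl] at h2
  rw [← h2]
  simp [turn, Segment.dir, Segment.translate]

theorem mid_toEdge (O : ℤ × ℤ) (S : Segment) :
    (toEdge O S).mid = (S.source - O) + (S.target - O) := by
  ext <;> simp [toEdge, mid, Segment.dir] <;> ring

/-- Disks contained in a curve through the centre. -/
theorem exists_disk (hF : Folds A k T) (hr : r.Compat k) (h0 : r.src = 0) (ρ : ℝ) :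
    ∃ c : ℝ × ℝ, ∀ S ∈ cover O k T,
      (∀ X ∈ S.support, ((X.1 : ℝ) - c.1) ^ 2 + ((X.2 : ℝ) - c.2) ^ 2 ≤ ρ ^ 2) →
      S ∈ curve O k T r := by
  -- Doubling midpoints multiplies squared distances by 4.
  obtain ⟨n, hn⟩ := exists_nat_ge (4 * ρ ^ 2)
  obtain ⟨c, hc⟩ := exists_ball n hF hr h0
  refine ⟨(O.1 + c.1 / 2, O.2 + c.2 / 2), fun S hS h => ⟨hS, hc _ hS.1 ?_⟩⟩
  have h1 := h S.source (Sym2.mem_mk_left _ _)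
  have h2 := h S.target (Sym2.mem_mk_right _ _)
  rw [mid_toEdge]
  have : ((nrm (S.source - O + (S.target - O) - c) : ℤ) : ℝ) ≤ ((5 + n : ℤ) : ℝ) := by
    simp only [nrm, Prod.fst_add, Prod.snd_add, Prod.fst_sub, Prod.snd_sub]
    push_cast
    simp only at h1 h2
    nlinarith [sq_nonneg ((S.source.1 : ℝ) - S.target.1), sq_nonneg ((S.source.2 : ℝ) - S.target.2)]
  exact_mod_cast this

theorem IsCovering.eq_of_support_eq {E : Set Segment} (hE : IsCovering E) (hS : S ∈ E)
    (hS' : S' ∈ E) (h : S.support = S'.support) : S = S' :=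
  (hE.1 _ _ S.unit_length).unique ⟨hS, rfl⟩ ⟨hS', h.symm⟩

theorem exists_mem_support_eq {E : Set Segment} (hE : IsCovering E) (S : Segment) :
    ∃ S' ∈ E, S'.support = S.support := (hE.1 _ _ S.unit_length).exists.imp fun _ h => h

/-- A covering with the local isomorphism property is determined by a curve through the centre. -/
theorem eq_cover {a : ℕ → ℤˣ} (ha : IsReflective a) (hF : Folds A k T) {C : ℤ → Segment}
    (hC : ∀ i, Consecutive (C i) (C (i + 1))) (hCE : ∀ i, C i ∈ cover O k T)
    (hO : (toEdge O (C 0)).tgt = 0)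
    (hturn : ∀ i, T (toEdge O (C i)).tgt = twoSided a (T 0) i)
    {E : Set Segment} (hE : IsCovering E) (hL : LocalIsomorphismProperty E)
    (hsub : Set.range C ⊆ E) : E = cover O k T := by
  have sub : E ⊆ cover O k T := by
    intro S hS
    -- Multiples of `(1 + i) ^ n` at which the turn is `T 0` preserve the turns at both ends of `S`;
    -- `1 ≤ n` makes them even.
    obtain ⟨n, hn1, hn2, hn⟩ := ((hF.eventually_turn_eq (toEdge O S).src).and
      ((hF.eventually_turn_eq (toEdge O S).tgt).and (eventually_ge_atTop 1))).exists
    obtain ⟨ρ, hρ, h⟩ := hL (insert S (C '' Set.Icc 0 (6 * 2 ^ n))) (by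
      rw [Set.insert_subset_iff]
      exact ⟨hS, (Set.image_subset_range _ _).trans hsub⟩) ((Set.toFinite _).insert _)
    have hr : (toEdge O (C 1)).Compat k := (hCE 1).1
    have hr0 : (toEdge O (C 1)).src = 0 := by
      have := (hC 0).toEdge_next (hCE 0).2.2
      rw [zero_add] at this
      rw [this, src_next, hO]
    obtain ⟨c, hc⟩ := exists_disk (O := O) hF hr hr0 ρ
    obtain ⟨v, hv⟩ := h c
    -- In the chosen disk all segments of the covering lie on `C`, hence in `E`; as `E` has one
    -- segment per support, the translates coincide with them.
    have mem : ∀ U ∈ insert S (C '' Set.Icc 0 (6 * 2 ^ n)), U.translate v ∈ cover O k T := by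
      intro U hU
      obtain ⟨h1, h2⟩ := hv U hU
      obtain ⟨V, hV, hVU⟩ := exists_mem_support_eq (isCovering_cover O k T) (U.translate v)
      have h3 : V ∈ Set.range C := by
        rw [range_eq_curve hC hCE]
        have h4 := hc V hV (by rw [hVU]; exact h2)
        refine ⟨hV, Equiv.Perm.SameCycle.trans ⟨1, ?_⟩ h4.2⟩
        rw [toEdge_zpow hC hCE 1]
      rwa [← hE.eq_of_support_eq (hsub h3) h1 hVU]
    have memC : ∀ i : ℕ, i ≤ 6 * 2 ^ n → (C i).translate v ∈ cover O k T := fun i hi =>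
      mem _ (Set.mem_insert_of_mem _ ⟨i, ⟨by positivity, by exact_mod_cast hi⟩, rfl⟩)
    have tgt_eq : ∀ U : Segment, (toEdge O (U.translate v)).tgt = (toEdge O U).tgt + v := by
      intro U
      rw [toEdge_translate]; ext <;> simp [tgt] <;> ring
    have orbit : ∀ i : ℕ, i ≤ 6 * 2 ^ n →
        toEdge O ((C i).translate v) = (next T ^ i) (toEdge O ((C 0).translate v)) := by
      intro i hi
      induction i with
      | zero => rfl
      | succ i ih =>
        rw [pow_succ', Equiv.Perm.mul_apply, ← ih (by omega)]
        exact ((hC i).translate v).toEdge_next (memC i (by omega)).2.2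
    have turn_v : ∀ i : ℕ, i ≤ 6 * 2 ^ n →
        T (toEdge O ((C i).translate v)).tgt = twoSided a (T 0) i := by
      intro i hi
      rw [← (memC i hi).2.2, ← hturn, ← (hCE i).2.2]
      rfl
    -- The translated piece of `C` lies in `cover` and still turns as `a` prescribes, so the image
    -- `v` of the centre is divisible by `(1 + i) ^ n`.
    obtain ⟨z, hz⟩ := exists_dbl_eq_tgt n ha hF (memC 0 (by positivity)).1 (fun i h0 h1 => by
      have h2 := orbit i h1
      rw [Nat.cast_zero]
      rw [← h2, turn_v i h1, twoSided_nat _ _ h0])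
    have hzv : dbl^[n] z = v := by
      rw [hz, tgt_eq, Nat.cast_zero, hO, zero_add]
    have hz0 : T (dbl^[n] z) = T 0 := by
      rw [hz, turn_v 0 (by positivity)]
      simp [twoSided]
    have e1 := hn1 z hz0
    have e2 := hn2 z hz0
    rw [hzv] at e1 e2
    refine (translate_mem_cover_iff ?_ e1 e2).1 (mem S (Set.mem_insert _ _))
    obtain ⟨m, rfl⟩ : ∃ m, n = m + 1 := ⟨n - 1, by omega⟩
    rw [← hzv, Function.iterate_succ_apply']
    exact dbl_even _
  refine sub.antisymm fun S hS => ?_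
  obtain ⟨S', h1, h2⟩ := exists_mem_support_eq hE S
  rwa [← eq_of_support_eq (sub h1) hS h2]

end Paperfolding

/-! ### Counting the curves. -/

namespace Paperfolding

open DEdge

variable {A : ℕ → ℤˣ} {O : ℤ × ℤ} {k : ℤ} {T : ℤ × ℤ → ℤˣ} {s s' r : DEdge} {a : ℕ → ℤˣ}

/-- The opposite edge at the same source. -/
def opp (r : DEdge) : DEdge := ⟨r.x, r.y, -r.p, -r.q⟩

theorem compat_opp (hr : r.Compat k) : (opp r).Compat k := by
  obtain ⟨h1, h2⟩ := hr
  exact ⟨by simpa [opp] using h1, by simp only [opp]; omega⟩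

theorem eq_or_eq_opp (hr : r.Compat k) (hs : s.Compat k) (h : r.src = 0) (h' : s.src = 0) :
    s = r ∨ s = opp r := by
  have h1 : r.x = 0 := congrArg Prod.fst h
  have h2 : r.y = 0 := congrArg Prod.snd h
  have h3 : s.x = 0 := congrArg Prod.fst h'
  have h4 : s.y = 0 := congrArg Prod.snd h'
  have e1 := hr.2
  have e2 := hs.2
  simp only [DEdge.ext_iff, opp]
  rcases unit_cases hr.1 with ⟨h5, h6⟩ | ⟨h5, h6⟩ | ⟨h5, h6⟩ | ⟨h5, h6⟩ <;>
    rcases unit_cases hs.1 with ⟨h7, h8⟩ | ⟨h7, h8⟩ | ⟨h7, h8⟩ | ⟨h7, h8⟩ <;> omega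

theorem opp_ne (hr : r.Compat k) : r ≠ opp r := by
  intro h
  have h1 : r.p = -r.p := congrArg DEdge.p h
  have h2 : r.q = -r.q := congrArg DEdge.q h
  have := Compat.odd_dir hr
  omega

theorem isCentral_iff (hr : r.Compat k) (h0 : r.src = 0) :
    IsCentral k T s ↔ (next T).SameCycle s r ∨ (next T).SameCycle s (opp r) := by
  constructor
  · rintro ⟨r', h1, h2, h3⟩
    rcases eq_or_eq_opp hr h1 h0 h3 with rfl | rfl
    · exact Or.inl h2
    · exact Or.inr h2
  · rintro (h | h)
    · exact ⟨r, hr, h, h0⟩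
    · exact ⟨opp r, compat_opp hr, h, h0⟩

/-- The curves associated to the folding sequence are the curves through the centre. -/
theorem isCurveAssociated_iff (ha : IsReflective a) (hA : ∀ m, A m = a (2 ^ m)) (hF : Folds A k T)
    (hs : s.Compat k) :
    IsCurveAssociated (curve O k T s) (twoSided a (T 0)) ↔ IsCentral k T s := by
  rw [isCurveAssociated_curve_iff hF hs]
  constructor
  · rintro ⟨r, h1, h2⟩
    have hr := compat_sameCycle h1 hs
    refine ⟨next T r, compat_next.2 hr, h1.trans ⟨1, by simp⟩, ?_⟩
    rw [src_next]
    refine eq_zero_of_forall_dbl fun n => exists_dbl_eq_tgt n ha hF hr fun i h3 _ => ?_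
    rw [← twoSided_nat a (T 0) h3, ← h2 i, zpow_natCast]
  · rintro ⟨r, h1, h2, h3⟩
    -- Index 0 is the turn at the centre, made at the target of the edge preceding `r`.
    refine ⟨(next T).symm r, h2.trans ⟨-1, by simp [Equiv.Perm.inv_def]⟩, fun i => ?_⟩
    exact turn_zpow_of_tgt_zero i.natAbs ha hA hF (compat_prev.2 h1) (by rw [tgt_next_symm, h3]) i
      le_rfl

theorem associated_curves_eq (ha : IsReflective a) (hA : ∀ m, A m = a (2 ^ m)) (hF : Folds A k T)
    (hr : r.Compat k) (h0 : r.src = 0) :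
    {K ∈ curvesIn (cover O k T) | IsCurveAssociated K (twoSided a (T 0))} =
      {curve O k T r, curve O k T (opp r)} := by
  ext K
  constructor
  · rintro ⟨hK, h⟩
    obtain ⟨s, hs, rfl⟩ := (mem_curvesIn_cover hF).1 hK
    rw [isCurveAssociated_iff ha hA hF hs, isCentral_iff hr h0] at h
    rw [Set.mem_insert_iff, Set.mem_singleton_iff, curve_eq_iff hs, curve_eq_iff hs]
    exact h
  · have key : ∀ {s}, s.Compat k → s.src = 0 → curve O k T s ∈
        {K ∈ curvesIn (cover O k T) | IsCurveAssociated K (twoSided a (T 0))} := fun hs h =>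
      ⟨(mem_curvesIn_cover hF).2 ⟨_, hs, rfl⟩, (isCurveAssociated_iff ha hA hF hs).2
        ⟨_, hs, Equiv.Perm.SameCycle.refl _ _, h⟩⟩
    rintro (rfl | rfl)
    · exact key hr h0
    · exact key (compat_opp hr) h0

theorem curve_ne_curve_opp (hF : Folds A k T) (hr : r.Compat k) (h0 : r.src = 0) :
    curve O k T r ≠ curve O k T (opp r) := by
  rw [Ne, curve_eq_iff hr]
  exact fun h => opp_ne hr (IsRep.eq_of_sameCycle hF hr (compat_opp hr) (Or.inl h0) (Or.inl h0) h)

theorem IsCentral.par (hF : Folds A k T) (hs : s.Compat k) (h : IsCentral k T s) :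
    IsCentral (nextType (A 0) k) (der T) (par T s) := by
  obtain ⟨r, h1, h2, h3⟩ := h
  exact ⟨_, compat_par hF h1, sameCycle_par hF hs h2, src_par_eq_zero h3⟩

/-- If the coefficients are eventually alternating, there are four curves which do not pass
through the centre. -/
theorem exists_noncentral (N : ℕ) : ∀ {A : ℕ → ℤˣ} {k : ℤ} {T : ℤ × ℤ → ℤˣ},
    Folds A k T → (∀ n, N ≤ n → A (n + 1) = -A n) →
    ∃ g : Fin 4 → DEdge, (∀ i, (g i).Compat k) ∧ (∀ i, ¬ IsCentral k T (g i)) ∧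
      (∀ i j, (next T).SameCycle (g i) (g j) → i = j) ∧
      ∀ s : DEdge, s.Compat k → IsCentral k T s ∨ ∃ i, (next T).SameCycle s (g i) := by
  induction N with
  | zero =>
    intro A k T hF hA
    have hA' : ∀ n, A (n + 1) = -A n := fun n => hA n (Nat.zero_le n)
    let e := (spiral (A 0)).equivFinOfCardEq (card_spiral _)
    choose g hg hgm using fun i : Fin 4 =>
      exists_compat_mid k (nrm_of_mem_spiral _ _ (e.symm i).2).2
    have hrep : ∀ i, IsRep A (g i) := fun i => Or.inr ⟨by rw [hgm]; exact (e.symm i).2, hA'⟩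
    refine ⟨g, hg, ?_, ?_, ?_⟩
    · rintro i ⟨r, h1, h2, h3⟩
      have h4 := IsRep.eq_of_sameCycle hF (hg i) h1 (hrep i) (Or.inl h3) h2
      have h5 := (nrm_of_mem_spiral _ _ (e.symm i).2).1
      rw [← hgm, h4, nrm_mid_of_src_eq_zero h1 h3] at h5
      norm_num at h5
    · intro i j h
      have h1 := congrArg mid (IsRep.eq_of_sameCycle hF (hg i) (hg j) (hrep i) (hrep j) h)
      rw [hgm, hgm] at h1
      exact e.symm.injective (Subtype.ext h1)
    · intro s hs
      obtain ⟨r, h1, h2 | ⟨h2, -⟩, h3⟩ := exists_isRep (nrm s.mid).toNat hF hs hA' (by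
        have := nrm_nonneg s.mid; omega)
      · exact Or.inl ⟨r, h1, h3, h2⟩
      · refine Or.inr ⟨e ⟨r.mid, h2⟩, ?_⟩
        have : g (e ⟨r.mid, h2⟩) = r := compat_mid_injective (hg _) h1 (by
          rw [hgm, Equiv.symm_apply_apply])
        rwa [this]
  | succ N ih =>
    intro A k T hF hA
    -- Derivation is a bijection on curves and preserves passing through the centre, so the first
    -- coefficients do not affect the count.
    obtain ⟨g', h1, h2, h3, h4⟩ := ih hF.shift fun n hn => hA (n + 1) (by omega)
    choose g hg _ hgp using fun i => exists_par_eq hF (h1 i)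
    refine ⟨g, hg, ?_, ?_, ?_⟩
    · intro i h
      have := h.par hF (hg i)
      rw [hgp] at this
      exact h2 i this
    · intro i j h
      have := sameCycle_par hF (hg i) h
      rw [hgp, hgp] at this
      exact h3 i j this
    · intro s hs
      rcases h4 _ (compat_par hF hs) with h | ⟨i, hi⟩
      · exact Or.inl (isCentral_of_par hF hs h)
      · exact Or.inr ⟨i, sameCycle_of_par hF hs (hg i) (by rwa [hgp])⟩

/-- An alternating tail is a tail of `(-1) ^ n` (cofinite case) or of its opposite (finite case). -/
theorem eventually_alternating_iff (A : ℕ → ℤˣ) :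
    ({n : ℕ | A n = (-1) ^ n}.Finite ∨ {n : ℕ | A n = (-1) ^ n}ᶜ.Finite) ↔
      ∃ N, ∀ n, N ≤ n → A (n + 1) = -A n := by
  have hsign : ∀ n, A n ≠ (-1) ^ n → A n = -(-1) ^ n := fun n h =>
    (Int.units_ne_iff_eq_neg).1 h
  constructor
  · rintro (h | h)
    · obtain ⟨N, hN⟩ := h.bddAbove
      refine ⟨N + 1, fun n hn => ?_⟩
      have h1 : A n ≠ (-1) ^ n := fun h => absurd (hN h) (by omega)
      have h2 : A (n + 1) ≠ (-1) ^ (n + 1) := fun h => absurd (hN h) (by omega)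
      rw [hsign _ h1, hsign _ h2, pow_succ, mul_neg_one]
    · obtain ⟨N, hN⟩ := h.bddAbove
      refine ⟨N + 1, fun n hn => ?_⟩
      have h1 : A n = (-1) ^ n := by
        by_contra h
        exact absurd (hN h) (by omega)
      have h2 : A (n + 1) = (-1) ^ (n + 1) := by
        by_contra h
        exact absurd (hN h) (by omega)
      rw [h1, h2, pow_succ, mul_neg_one]
  · rintro ⟨N, hN⟩
    by_cases h : A N = (-1) ^ N
    · right
      have h1 : ∀ n, N ≤ n → A n = (-1) ^ n := by
        intro n hn
        induction n, hn using Nat.le_induction with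
        | base => exact h
        | succ n hn ih => rw [hN n hn, ih, pow_succ, mul_neg_one]
      refine (Set.finite_lt_nat N).subset fun n hn => ?_
      by_contra h2
      exact hn (h1 n (not_lt.1 h2))
    · left
      have h1 : ∀ n, N ≤ n → A n = -(-1) ^ n := by
        intro n hn
        induction n, hn using Nat.le_induction with
        | base => exact hsign N h
        | succ n hn ih => rw [hN n hn, ih, pow_succ, mul_neg_one]
      refine (Set.finite_lt_nat N).subset fun n hn => ?_
      by_contra h2
      have h3 := h1 n (not_lt.1 h2)
      rw [show A n = (-1) ^ n from hn] at h3
      rcases neg_one_pow_eq_or ℤˣ n with h4 | h4 <;> rw [h4] at h3 <;> revert h3 <;> decide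

theorem ncard_not_associated (ha : IsReflective a) (hA : ∀ m, A m = a (2 ^ m)) (hF : Folds A k T)
    {N : ℕ} (hN : ∀ n, N ≤ n → A (n + 1) = -A n) :
    {K ∈ curvesIn (cover O k T) | ¬ IsCurveAssociated K (twoSided a (T 0))}.ncard = 4 := by
  obtain ⟨g, h1, h2, h3, h4⟩ := exists_noncentral N hF hN
  have e : {K ∈ curvesIn (cover O k T) | ¬ IsCurveAssociated K (twoSided a (T 0))} =
      (fun i => curve O k T (g i)) '' Set.univ := by
    ext K
    constructor
    · rintro ⟨hK, h⟩
      obtain ⟨s, hs, rfl⟩ := (mem_curvesIn_cover hF).1 hK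
      rw [isCurveAssociated_iff ha hA hF hs] at h
      obtain ⟨i, hi⟩ := (h4 s hs).resolve_left h
      exact ⟨i, trivial, ((curve_eq_iff hs).2 hi).symm⟩
    · rintro ⟨i, -, rfl⟩
      exact ⟨(mem_curvesIn_cover hF).2 ⟨_, h1 i, rfl⟩, fun h =>
        h2 i ((isCurveAssociated_iff ha hA hF (h1 i)).1 h)⟩
  rw [e, Set.ncard_image_of_injective _ fun i j h => h3 i j ((curve_eq_iff (h1 i)).1 h),
    Set.ncard_univ, Nat.card_eq_fintype_card, Fintype.card_fin]

theorem isCentral_of_frequently (hF : Folds A k T) (hs : s.Compat k)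
    (h : ¬ ∃ N, ∀ n, N ≤ n → A (n + 1) = -A n) : IsCentral k T s := by
  refine isCentral_of_not_alternating (nrm s.mid).toNat hF hs (fun N => ?_) (by
    have := nrm_nonneg s.mid; omega)
  by_contra hc
  push Not at hc
  exact h ⟨N, fun n hn => (Int.units_ne_iff_eq_neg).1 (hc n hn)⟩

/-- A complete curve associated to a folding sequence with a centre is contained in the covering
with the corresponding turns. -/
theorem mem_cover_of_isAssociated (ha : IsReflective a) (hA : ∀ m, A m = a (2 ^ m))
    (hF : Folds A k T) {C : ℤ → Segment} (hC : ∀ i, Consecutive (C i) (C (i + 1)))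
    (hS : IsAssociated C (twoSided a (T 0))) (hk : (toEdge (C 0).target (C 1)).Compat k) (i : ℤ) :
    C i ∈ cover (C 0).target k T ∧
      T (toEdge (C 0).target (C i)).tgt = twoSided a (T 0) i := by
  set O := (C 0).target with hO
  set r := toEdge O (C 1) with hr
  have hbend : ∀ i, (C i).bendTarget = twoSided a (T 0) i := fun i =>
    Units.ext ((hC i).2.1.symm.trans (hS i))
  have h0 : r.src = 0 := by
    have h1 := (hC 0).1
    rw [zero_add] at h1
    rw [hr, src_toEdge, h1, hO, sub_self]
  have ht : ∀ j : ℤ, T ((next T ^ j) ((next T).symm r)).tgt = twoSided a (T 0) j := fun j =>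
    turn_zpow_of_tgt_zero j.natAbs ha hA hF (compat_prev.2 hk) (by rw [tgt_next_symm, h0]) j le_rfl
  have hz : ∀ j : ℤ, (next T ^ (j + 1)) ((next T).symm r) = (next T ^ j) r := by
    intro j
    rw [zpow_next_add, zpow_one, Equiv.apply_symm_apply]
  have hsrc : ∀ j : ℤ, T ((next T ^ j) r).src = twoSided a (T 0) j := by
    intro j
    rw [← hz, zpow_next_succ, src_next, ht]
  -- Forwards, the bend at the target determines the next edge; backwards, the same turn is known at
  -- the source of the following edge, by `hsrc`.
  have orbit : ∀ j : ℤ, toEdge O (C (j + 1)) = (next T ^ j) r := by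
    intro j
    induction j using Int.induction_on with
    | zero => simp [hr]
    | succ j ih =>
      rw [(hC (j + 1)).toEdge_next (T := T) (by rw [hbend, ih, ← ht, hz]), ih, zpow_next_succ]
    | pred j ih =>
      have h1 : (toEdge O (C (-j + 1))).src = (toEdge O (C (-j))).tgt := by
        rw [src_toEdge, tgt_toEdge, (hC (-j)).1]
      have h2 := (hC (-j)).toEdge_next (O := O) (T := T) (by rw [← h1, ih, hsrc, hbend])
      rw [ih, ← Equiv.symm_apply_eq] at h2
      rw [sub_add_cancel, ← h2, show -(j : ℤ) - 1 = -1 + -j by ring, zpow_next_add, zpow_neg_one]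
      rfl
  have orbit' : ∀ j : ℤ, toEdge O (C j) = (next T ^ j) ((next T).symm r) := by
    intro j
    have := orbit (j - 1)
    rwa [sub_add_cancel, ← hz, sub_add_cancel] at this
  refine ⟨⟨?_, ?_, ?_⟩, ?_⟩
  · rw [orbit']
    exact (compat_zpow i).2 (compat_prev.2 hk)
  · have h1 := (hC (i - 1)).2.2
    rw [sub_add_cancel] at h1
    have h2 := orbit (i - 1)
    rw [sub_add_cancel] at h2
    rw [h1, hbend, h2, hsrc]
  · rw [orbit', ht, hbend]
  · rw [orbit', ht]

end Paperfolding

open Paperfolding in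
theorem theorem3p15 (a : ℕ → ℤˣ) (ha : Paperfolding.IsInftyFolding a) (ε : ℤˣ)
    (C : ℤ → Paperfolding.Segment) (hC : Paperfolding.IsCompleteCurve C)
    (hS : Paperfolding.IsAssociated C (Paperfolding.twoSided a ε)) :
    ∃ E : Set Paperfolding.Segment,
      Paperfolding.IsGoodCovering C E ∧
      (∀ E', Paperfolding.IsGoodCovering C E' → E' = E) ∧
      (({n : ℕ | a (2 ^ n) = (-1) ^ n}.Finite ∨ {n : ℕ | a (2 ^ n) = (-1) ^ n}ᶜ.Finite) →
        {K ∈ Paperfolding.curvesIn E |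
          Paperfolding.IsCurveAssociated K (Paperfolding.twoSided a ε)}.ncard = 2 ∧
        {K ∈ Paperfolding.curvesIn E |
          ¬ Paperfolding.IsCurveAssociated K (Paperfolding.twoSided a ε)}.ncard = 4) ∧
      (¬ ({n : ℕ | a (2 ^ n) = (-1) ^ n}.Finite ∨ {n : ℕ | a (2 ^ n) = (-1) ^ n}ᶜ.Finite) →
        (Paperfolding.curvesIn E).ncard = 2 ∧
        ∀ K ∈ Paperfolding.curvesIn E,
          Paperfolding.IsCurveAssociated K (Paperfolding.twoSided a ε)) := by
  have hR := ha.isReflective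
  set O := (C 0).target with hO
  set r := toEdge O (C 1) with hr
  -- `C 1` starts at the origin, so it is compatible exactly with the types of the parity of `r.p`.
  obtain ⟨T, hF, rfl⟩ := exists_folds (fun n => a (2 ^ n)) r.p ε
  have hA : ∀ m, (fun n => a (2 ^ n)) m = a (2 ^ m) := fun _ => rfl
  have h0 : r.src = 0 := by
    have h1 := (hC.1 0).1
    rw [zero_add] at h1
    rw [hr, src_toEdge, h1, hO, sub_self]
  have hk : r.Compat r.p := by
    have h1 : r.x = 0 := congrArg Prod.fst h0
    have h2 : r.y = 0 := congrArg Prod.snd h0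
    exact ⟨dir_unit (C 1), by omega⟩
  have hmem := mem_cover_of_isAssociated hR hA hF hC.1 hS hk
  have hassoc := associated_curves_eq (O := O) hR hA hF hk h0
  have hpair := Set.ncard_pair (curve_ne_curve_opp (O := O) hF hk h0)
  refine ⟨cover O r.p T, ⟨isCoveringByFoldingCurves_cover hR hF, localIsomorphismProperty_cover hF,
    Set.range_subset_iff.2 fun i => (hmem i).1⟩, ?_, ?_, ?_⟩
  · rintro E' ⟨h1, h2, h3⟩
    exact eq_cover hR hF hC.1 (fun i => (hmem i).1) (by rw [tgt_toEdge, sub_self])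
      (fun i => (hmem i).2) h1.1 h2 h3
  · intro h
    obtain ⟨N, hN⟩ := (eventually_alternating_iff fun n => a (2 ^ n)).1 h
    exact ⟨by rw [hassoc, hpair], ncard_not_associated hR hA hF hN⟩
  · intro h
    have hcen : ∀ K ∈ curvesIn (cover O r.p T), IsCurveAssociated K (twoSided a (T 0)) := by
      intro K hK
      obtain ⟨s, hs, rfl⟩ := (mem_curvesIn_cover hF).1 hK
      exact (isCurveAssociated_iff hR hA hF hs).2 (isCentral_of_frequently hF hs fun h1 =>
        h ((eventually_alternating_iff fun n => a (2 ^ n)).2 h1))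
    refine ⟨?_, hcen⟩
    rw [← hpair, ← hassoc]
    congr 1
    ext K
    exact ⟨fun hK => ⟨hK, hcen K hK⟩, fun hK => hK.1⟩
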